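/- Let $N\ge 1$ and $m$ be natural numbers, $1<p<\infty$, $1<q<\infty$, and let $p^*=\frac{pN}{N-p}$ if $p<N$, while $p^*\in(p,\infty)$ is arbitrary but fixed if $p\ge N$. Write $\mathbb R_+=[0,\infty)$. Let $G:\mathbb R_+^m\to\mathbb R_+$ be continuous, let $V:\mathbb R_+\to\mathbb R_+$ be measurable, and suppose that: (G1) there are a constant $K\ge 0$ and exponents $\mu_1,\dots,\mu_m$ with $p\,\frac{2q-1}{2q}<\mu_i<p^*\,\frac{2q-1}{2q}$ such that $G(s)\le K\sum_{i=1}^m s_i^{\mu_i}$ for all $s\in\mathbb R_+^m$; (G2) $V(|\cdot|)$ belongs to weak $L^q(\mathbb R^N)$, i.e. $\sup_{h>0}h^q\,|\{x\in\mathbb R^N: V(|x|)\ge h\}|<\infty$, and $N\big(\frac{\mu_i}{p}-\frac{2q-1}{2q}\big)<\frac p2$ for every $i$; (G3) $V$ is non-increasing on $(0,\infty)$; (G4) $G$ is non-decreasing in each variable and supermodular: for all $y\in\mathbb R_+^m$, $h,k\ge0$ and all indices $i$, $G(y+he_i)\ge G(y)$, and for all $i\ne j$, $G(y+he_i+ke_j)+G(y)\ge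 G(y+he_i)+G(y+ke_j)$, where $e_i$ is the $i$-th unit vector of $\mathbb R^m$. For measurable $U=(u_1,\dots,u_m):\mathbb R^N\to\mathbb R_+^m$ set $$Q(U)=\int_{\mathbb R^N}\int_{\mathbb R^N}G(U(x))\,V(|x-y|)\,G(U(y))\,dx\,dy\in[0,\infty].$$ Let $U=(u_1,\dots,u_m)$ with $u_i\in L^p(\mathbb R^N)\cap L^{p^*}(\mathbb R^N)$ and $u_i\ge0$. Then: (a) For every closed half-space $H=\{x: x\cdot e\ge t\}$ ($|e|=1$, $t\in\mathbb R$), $Q(U^H)\ge Q(U)$. Here $U^H=(u_1^H,\dots,u_m^H)$ is the polarization with respect to $H$: $u^H(x)=\max\{u(x),u(x_H)\}$ for $x\in H$ and $u^H(x)=\min\{u(x),u(x_H)\}$ for $x\notin H$, where $x_H$ is the reflection of $x$ in the hyperplane $\partial H$. (b) $Q(U^*)\ge Q(U)$. Here $U^*=(u_1^*,\dots,u_m^*)$ and $u^*$ is the Schwarz rearrangement of $u$, i.e. the function (unique up to null sets) that is radially symmetric, radially non-increasing on $\mathbb R^N\setminus\{0\}$ and satisfies $|\{u^*>h\}|=|\{u>h\}|$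 for every $h>0$. -/

import Mathlib

open scoped NNReal ENNReal
open MeasureTheory

namespace Rearrangement

/-- Reflection of `x` with respect to the hyperplane `{y | ⟪y, e⟫ = t}`, for a unit vector `e`. -/
noncomputable def reflect {N : ℕ} (e : EuclideanSpace ℝ (Fin N)) (t : ℝ)
    (x : EuclideanSpace ℝ (Fin N)) : EuclideanSpace ℝ (Fin N) :=
  x + (2 * (t - inner ℝ x e)) • e

/-- The closed half-space `{x | ⟪x, e⟫ ≥ t}`, for a unit vector `e`. -/
def halfSpace {N : ℕ} (e : EuclideanSpace ℝ (Fin N)) (t : ℝ) : Set (EuclideanSpace ℝ (Fin N)) :=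
  {x | t ≤ inner ℝ x e}

open Classical in
/-- Polarization of `u` with respect to the half-space `halfSpace e t`: with `v` the reflected
function, it is `max u v` on the half-space and `min u v` on the complement. -/
noncomputable def polarize {N : ℕ} (e : EuclideanSpace ℝ (Fin N)) (t : ℝ)
    (u : EuclideanSpace ℝ (Fin N) → ℝ≥0) (x : EuclideanSpace ℝ (Fin N)) : ℝ≥0 :=
  if x ∈ halfSpace e t then max (u x) (u (reflect e t x)) else min (u x) (u (reflect e t x))

/-- The Schwarz rearrangement of `u`: its value at `x` is the supremum of the levels `h` for which
the superlevel set `{u > h}` has larger volume than the ball of radius `‖x‖`.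
The value at the origin, where this supremum may be infinite, is immaterial. -/
noncomputable def schwarz {N : ℕ} (u : EuclideanSpace ℝ (Fin N) → ℝ≥0)
    (x : EuclideanSpace ℝ (Fin N)) : ℝ≥0 :=
  sSup {h : ℝ≥0 | volume (Metric.ball (0 : EuclideanSpace ℝ (Fin N)) ‖x‖) < volume {y | h < u y}}

/-- The defining property of a Schwarz rearrangement `v` of `u`: it is radially symmetric, radially
non-increasing (away from the origin, where an unbounded function has no admissible finite value),
and equimeasurable with `u`. -/
structure IsSchwarzRearrangement {N : ℕ} (u v : EuclideanSpace ℝ (Fin N) → ℝ≥0) : Prop where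
  radial : ∀ x y, ‖x‖ = ‖y‖ → v x = v y
  noninc : ∀ x y, 0 < ‖x‖ → ‖x‖ ≤ ‖y‖ → v y ≤ v x
  equimeasurable : ∀ h : ℝ≥0, 0 < h → volume {x | h < u x} = volume {x | h < v x}

/-- The supremum in `schwarz` is over a bounded set of levels, if `u` is in some `L^p`. -/
theorem bddAbove_levels {N : ℕ} {p : ℝ} (hp : 1 < p) {u : EuclideanSpace ℝ (Fin N) → ℝ≥0}
    (hu : MemLp (fun x => (u x : ℝ)) (ENNReal.ofReal p) volume)
    (x : EuclideanSpace ℝ (Fin N)) (hx : 0 < ‖x‖) :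
    BddAbove {h : ℝ≥0 | volume (Metric.ball (0 : EuclideanSpace ℝ (Fin N)) ‖x‖)
      < volume {y | h < u y}} := by
  have hb0 : volume (Metric.ball (0 : EuclideanSpace ℝ (Fin N)) ‖x‖) ≠ 0 :=
    (Metric.measure_ball_pos volume _ hx).ne'
  set b := volume (Metric.ball (0 : EuclideanSpace ℝ (Fin N)) ‖x‖) with hb
  set C := eLpNorm (fun x => (u x : ℝ)) (ENNReal.ofReal p) volume ^ (ENNReal.ofReal p).toReal
    with hC
  have hCtop : C ≠ ∞ := ENNReal.rpow_ne_top_of_nonneg ENNReal.toReal_nonneg hu.2.ne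
  have hpt : (ENNReal.ofReal p).toReal = p := ENNReal.toReal_ofReal (by linarith)
  refine ⟨max 1 (C / b).toNNReal, fun h hh => ?_⟩
  rcases le_total h 1 with h1 | h1
  · exact h1.trans (le_max_left _ _)
  refine le_trans ?_ (le_max_right _ _)
  have hfin : C / b ≠ ∞ := ENNReal.div_ne_top hCtop hb0
  rw [← ENNReal.coe_le_coe, ENNReal.coe_toNNReal hfin,
    ENNReal.le_div_iff_mul_le (Or.inl hb0) (Or.inr hCtop)]
  have key := mul_meas_ge_le_pow_eLpNorm' (μ := volume) (f := fun x => (u x : ℝ))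
    (p := ENNReal.ofReal p) (by simp; linarith) ENNReal.ofReal_ne_top hu.1 (h : ℝ≥0∞)
  refine le_trans ?_ key
  gcongr
  · rw [hpt]
    calc (h : ℝ≥0∞) = (h : ℝ≥0∞) ^ (1 : ℝ) := by simp
      _ ≤ _ := ENNReal.rpow_le_rpow_of_exponent_le (by exact_mod_cast h1) hp.le
  · refine (le_of_lt hh).trans (measure_mono fun y hy => ?_)
    have : ‖(u y : ℝ)‖ₑ = (u y : ℝ≥0∞) := by simp
    simp only [Set.mem_ofPred_eq, this]
    exact_mod_cast (le_of_lt hy)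

/-- The function built above is the Schwarz rearrangement. -/
theorem isSchwarzRearrangement_schwarz {N : ℕ} (hN : 0 < N) {p : ℝ} (hp : 1 < p)
    {u : EuclideanSpace ℝ (Fin N) → ℝ≥0}
    (hu : MemLp (fun x => (u x : ℝ)) (ENNReal.ofReal p) volume) :
    IsSchwarzRearrangement u (schwarz u) := by
  have : Nonempty (Fin N) := ⟨⟨0, hN⟩⟩
  refine ⟨fun x y hxy => by simp only [schwarz, hxy], fun x y hx hxy => ?_, fun h hh => ?_⟩
  · refine csSup_le_csSup' (bddAbove_levels hp hu x hx) fun h hh => ?_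
    exact lt_of_le_of_lt (measure_mono (Metric.ball_subset_ball hxy)) hh
  · have hfin : volume {x | h < u x} ≠ ∞ := by
      have := hu.meas_ge_lt_top (by simp; linarith) ENNReal.ofReal_ne_top (ε := h) hh.ne'
      refine ne_top_of_le_ne_top this.ne (measure_mono fun y hy => ?_)
      simpa [← NNReal.coe_le_coe] using (le_of_lt hy : h ≤ u y)
    have hiff : ∀ x : EuclideanSpace ℝ (Fin N), 0 < ‖x‖ → (h < schwarz u x ↔
        volume (Metric.ball (0 : EuclideanSpace ℝ (Fin N)) ‖x‖) < volume {y | h < u y}) := by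
      intro x hx
      constructor
      · intro hlt
        obtain ⟨k, hk, hhk⟩ := exists_lt_of_lt_csSup' hlt
        exact lt_of_lt_of_le hk (measure_mono fun y hy => hhk.trans hy)
      · intro hlt
        have hU : {y | h < u y} = ⋃ n : ℕ, {y | h + 1 / ((n : ℝ≥0) + 1) < u y} := by
          ext y
          simp only [Set.mem_ofPred_eq, Set.mem_iUnion]
          constructor
          · intro hy
            obtain ⟨n, hn⟩ := exists_nat_one_div_lt (K := ℝ≥0) (tsub_pos_of_lt hy)
            exact ⟨n, by rw [add_comm]; exact lt_tsub_iff_right.mp hn⟩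
          · rintro ⟨n, hn⟩
            exact lt_of_le_of_lt le_self_add hn
        have hmono : Monotone fun n : ℕ => {y | h + 1 / ((n : ℝ≥0) + 1) < u y} := by
          intro a b hab y hy
          refine lt_of_le_of_lt ?_ (show h + 1 / ((a : ℝ≥0) + 1) < u y from hy)
          gcongr
        rw [hU, hmono.measure_iUnion, lt_iSup_iff] at hlt
        obtain ⟨n, hn⟩ := hlt
        refine lt_of_lt_of_le ?_ (le_csSup (bddAbove_levels hp hu x hx) hn)
        exact lt_add_of_pos_right _ (by positivity)
    set a := volume {x | h < u x} with ha
    set c := volume (Metric.ball (0 : EuclideanSpace ℝ (Fin N)) 1) with hc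
    have hc0 : c ≠ 0 := (Metric.measure_ball_pos volume _ one_pos).ne'
    have hct : c ≠ ∞ := measure_ball_lt_top.ne
    have hball : ∀ r : ℝ, 0 ≤ r → volume (Metric.ball (0 : EuclideanSpace ℝ (Fin N)) r)
        = ENNReal.ofReal (r ^ N) * c := by
      intro r hr
      simpa using Measure.addHaar_ball (volume : Measure (EuclideanSpace ℝ (Fin N))) 0 hr
    obtain ⟨r, hr, hra⟩ : ∃ r : ℝ, 0 ≤ r ∧ ENNReal.ofReal (r ^ N) * c = a := by
      refine ⟨(a / c).toReal ^ ((N : ℝ)⁻¹), by positivity, ?_⟩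
      rw [Real.rpow_inv_natCast_pow ENNReal.toReal_nonneg hN.ne',
        ENNReal.ofReal_toReal (ENNReal.div_ne_top hfin hc0), ENNReal.div_mul_cancel hc0 hct]
    have hae : {x | h < schwarz u x} =ᵐ[volume] Metric.ball (0 : EuclideanSpace ℝ (Fin N)) r := by
      have h0 : ∀ᵐ x : EuclideanSpace ℝ (Fin N), x ≠ 0 := by
        simp [ae_iff]
      filter_upwards [h0] with x hx
      have hx' : 0 < ‖x‖ := norm_pos_iff.mpr hx
      apply propext
      change h < schwarz u x ↔ x ∈ Metric.ball (0 : EuclideanSpace ℝ (Fin N)) r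
      rw [hiff x hx', hball _ hx'.le, ← hra, mem_ball_zero_iff,
        ENNReal.mul_lt_mul_iff_left hc0 hct]
      constructor
      · intro hlt
        by_contra hle
        push Not at hle
        exact absurd hlt (not_lt.mpr (ENNReal.ofReal_le_ofReal (pow_le_pow_left₀ hr hle N)))
      · intro hlt
        exact (ENNReal.ofReal_lt_ofReal_iff_of_nonneg (by positivity)).mpr
          (pow_lt_pow_left₀ hlt hx'.le hN.ne')
    rw [measure_congr hae, hball r hr, hra]

/-- Weak `L^q` on `ℝ^N`: `sup_{h > 0} h^q |{|f| ≥ h}| < ∞`. -/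
def MemWeakLp {N : ℕ} (q : ℝ) (f : EuclideanSpace ℝ (Fin N) → ℝ) : Prop :=
  AEMeasurable f volume ∧
    (⨆ (h : ℝ) (_ : 0 < h), ENNReal.ofReal (h ^ q) * volume {x | h ≤ |f x|}) < ∞

/-- `G` is non-decreasing in each variable. -/
def NondecreasingInEach {m : ℕ} (G : (Fin m → ℝ≥0) → ℝ≥0) : Prop :=
  ∀ (y : Fin m → ℝ≥0) (h : ℝ≥0) (i : Fin m), G y ≤ G (y + Pi.single i h)

/-- `G` is supermodular. -/
def Supermodular {m : ℕ} (G : (Fin m → ℝ≥0) → ℝ≥0) : Prop :=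
  ∀ (y : Fin m → ℝ≥0) (h k : ℝ≥0) (i j : Fin m), i ≠ j →
    G (y + Pi.single i h) + G (y + Pi.single j k)
      ≤ G (y + Pi.single i h + Pi.single j k) + G y

/-- `Q(U) = ∫∫ G(U(x)) V(|x - y|) G(U(y)) dx dy`, with values in `[0, ∞]`. -/
noncomputable def Q {N m : ℕ} (G : (Fin m → ℝ≥0) → ℝ≥0) (V : ℝ≥0 → ℝ≥0)
    (U : Fin m → EuclideanSpace ℝ (Fin N) → ℝ≥0) : ℝ≥0∞ :=
  ∫⁻ x, ∫⁻ y, ((G (fun i => U i x) * V ‖x - y‖₊ * G (fun i => U i y) : ℝ≥0) : ℝ≥0∞)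

end Rearrangement

/-! For (a), folding both variables by the reflection turns the double integral into integrals of
sums over four pairs of points. If `x` and `y` lie in the half-space, `|x - y|` is at most `|x -
y_H|`, so the kernel is larger for points on the same side. Polarization replaces the vectors
`U(x)`, `U(x_H)` by their join and meet. Monotonicity of `G` makes the difference of its two values
grow, and supermodularity makes their sum grow; `four_point` shows that this suffices.

For (b), consider first a bounded kernel and functions with finitely many values and bounded
support. Polarizing with respect to a half-space containing the origin keeps the volumes of
superlevel sets and does not decrease `Q`. It also never increases the `excess`, the volume of
superlevel sets outside the centred balls of equal volume. If a superlevel set `A` differs from its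
ball `B`, then `A \ B` and `B \ A` have equal positive volume. Averaging over all translations,
written in polar coordinates, yields a reflection that carries a definite part of `A \ B` into `B \
A` (`exists_reflect_overlap`). The resulting gain depends only on a lower bound for the excess, so
the infimum of the excess over admissible competitors is zero, and no convergent sequence of
polarizations is needed. Small excess means that `Q` nearly agrees with its value at the radial
function.

The general case follows by truncation and discretization from below: Fatou's lemma handles the left
side, and the approximating radial functions lie below the Schwarz rearrangement. -/

namespace Rearrangement

/-! ### Reflections and polarization of functions -/

section Reflection

variable {N : ℕ} {e : EuclideanSpace ℝ (Fin N)} {t : ℝ}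

theorem inner_reflect (he : ‖e‖ = 1) (x : EuclideanSpace ℝ (Fin N)) :
    inner ℝ (reflect e t x) e - t = -(inner ℝ x e - t) := by
  simp only [reflect, inner_add_left, real_inner_smul_left, real_inner_self_eq_norm_sq, he]
  ring

theorem reflect_reflect (he : ‖e‖ = 1) (x : EuclideanSpace ℝ (Fin N)) :
    reflect e t (reflect e t x) = x := by
  have h := inner_reflect (t := t) he x
  rw [reflect, show t - inner ℝ (reflect e t x) e = -(t - inner ℝ x e) by linarith, reflect]
  module

/-- The source of all distance comparisons: the sign of the last product tells whether `x` and `y`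
lie on the same side of the hyperplane. -/
theorem norm_sub_reflect_sq (he : ‖e‖ = 1) (x y : EuclideanSpace ℝ (Fin N)) :
    ‖x - reflect e t y‖ ^ 2 = ‖x - y‖ ^ 2 + 4 * (inner ℝ x e - t) * (inner ℝ y e - t) := by
  have : x - reflect e t y = (x - y) + (2 * (inner ℝ y e - t)) • e := by
    rw [reflect]; module
  rw [this, norm_add_sq_real, real_inner_smul_right, norm_smul, inner_sub_left, he, mul_one,
    Real.norm_eq_abs, sq_abs]
  ring

theorem norm_reflect_sub_reflect (he : ‖e‖ = 1) (x y : EuclideanSpace ℝ (Fin N)) :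
    ‖reflect e t x - reflect e t y‖ = ‖x - y‖ := by
  rw [← sq_eq_sq₀ (norm_nonneg _) (norm_nonneg _), norm_sub_reflect_sq he,
    norm_sub_rev _ y, norm_sub_reflect_sq he, inner_reflect he, norm_sub_rev y x]
  ring

theorem norm_reflect_sub (he : ‖e‖ = 1) (x y : EuclideanSpace ℝ (Fin N)) :
    ‖reflect e t x - y‖ = ‖x - reflect e t y‖ := by
  rw [← norm_reflect_sub_reflect (t := t) he x, reflect_reflect he]

theorem norm_reflect_sq (he : ‖e‖ = 1) (x : EuclideanSpace ℝ (Fin N)) :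
    ‖reflect e t x‖ ^ 2 = ‖x‖ ^ 2 - 4 * t * (inner ℝ x e - t) := by
  have := norm_sub_reflect_sq (t := t) he 0 x
  simp only [zero_sub, norm_neg, inner_zero_left] at this
  rw [this]; ring

theorem reflect_mem_halfSpace (he : ‖e‖ = 1) {x : EuclideanSpace ℝ (Fin N)}
    (hx : x ∉ halfSpace e t) : reflect e t x ∈ halfSpace e t := by
  have := inner_reflect (t := t) he x
  simp only [halfSpace, Set.mem_ofPred_eq, not_le] at hx ⊢
  linarith

theorem reflect_eq_self (he : ‖e‖ = 1) {x : EuclideanSpace ℝ (Fin N)}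
    (hx : x ∈ halfSpace e t) (hx' : reflect e t x ∈ halfSpace e t) : reflect e t x = x := by
  have := inner_reflect (t := t) he x
  simp only [halfSpace, Set.mem_ofPred_eq] at hx hx'
  rw [reflect, show t - inner ℝ x e = 0 by linarith]
  simp

theorem measurable_reflect_uncurry :
    Measurable fun z : ℝ × EuclideanSpace ℝ (Fin N) => reflect e z.1 z.2 := by
  unfold reflect
  fun_prop

theorem measurable_reflect : Measurable (reflect e t) :=
  measurable_reflect_uncurry.comp (measurable_const.prodMk measurable_id)

theorem measurePreserving_reflect (he : ‖e‖ = 1) :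
    MeasurePreserving (reflect e t) volume volume := by
  -- The affine reflection is the linear isometry reflecting in `e`'s orthogonal hyperplane,
  -- followed by a translation.
  let L := (Submodule.span ℝ {e})ᗮ.reflection
  have h : reflect e t = (fun z => z + (2 * t) • e) ∘ L := by
    ext1 x
    simp only [L, Function.comp, Submodule.reflection_orthogonal_apply,
      Submodule.reflection_singleton_apply, reflect, he, real_inner_comm]
    simp
    module
  rw [h]
  exact (measurePreserving_add_right volume _).comp L.measurePreserving

theorem measurableEmbedding_reflect (he : ‖e‖ = 1) : MeasurableEmbedding (reflect e t) :=
  (MeasurableEquiv.mk ⟨reflect e t, reflect e t, reflect_reflect he, reflect_reflect he⟩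
    measurable_reflect measurable_reflect).measurableEmbedding

theorem lintegral_comp_reflect (he : ‖e‖ = 1) (f : EuclideanSpace ℝ (Fin N) → ℝ≥0∞) :
    ∫⁻ x, f (reflect e t x) = ∫⁻ x, f x :=
  (measurePreserving_reflect he).lintegral_comp_emb (measurableEmbedding_reflect he) f

theorem measure_preimage_reflect (he : ‖e‖ = 1) (s : Set (EuclideanSpace ℝ (Fin N))) :
    volume (reflect e t ⁻¹' s) = volume s :=
  (measurePreserving_reflect he).measure_preimage_emb (measurableEmbedding_reflect he) s

theorem measurableSet_halfSpace : MeasurableSet (halfSpace e t) :=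
  measurableSet_le measurable_const (by fun_prop)

theorem polarize_of_mem {u : EuclideanSpace ℝ (Fin N) → ℝ≥0} {x : EuclideanSpace ℝ (Fin N)}
    (hx : x ∈ halfSpace e t) : polarize e t u x = max (u x) (u (reflect e t x)) := if_pos hx

theorem polarize_of_notMem {u : EuclideanSpace ℝ (Fin N) → ℝ≥0} {x : EuclideanSpace ℝ (Fin N)}
    (hx : x ∉ halfSpace e t) : polarize e t u x = min (u x) (u (reflect e t x)) := if_neg hx

theorem polarize_reflect (he : ‖e‖ = 1) {u : EuclideanSpace ℝ (Fin N) → ℝ≥0}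
    {x : EuclideanSpace ℝ (Fin N)} (hx : x ∈ halfSpace e t) :
    polarize e t u (reflect e t x) = min (u x) (u (reflect e t x)) := by
  by_cases h : reflect e t x ∈ halfSpace e t
  · rw [reflect_eq_self he hx h, polarize_of_mem hx, reflect_eq_self he hx h]
    simp
  · rw [polarize_of_notMem h, reflect_reflect he, min_comm]

theorem measurable_polarize {u : EuclideanSpace ℝ (Fin N) → ℝ≥0} (hu : Measurable u) :
    Measurable (polarize e t u) :=
  Measurable.ite measurableSet_halfSpace (hu.max (hu.comp measurable_reflect))
    (hu.min (hu.comp measurable_reflect))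

theorem polarize_congr_ae (he : ‖e‖ = 1) {u v : EuclideanSpace ℝ (Fin N) → ℝ≥0}
    (h : u =ᵐ[volume] v) : polarize e t u =ᵐ[volume] polarize e t v := by
  filter_upwards [h, (measurePreserving_reflect (t := t) he).quasiMeasurePreserving.ae h] with x h1 h2
  simp only [polarize, h1, h2]

end Reflection

/-! ### From coordinate increments to lattice inequalities -/

section Supermodular

variable {m : ℕ} {G : (Fin m → ℝ≥0) → ℝ≥0}

theorem NondecreasingInEach.le_add_sum (hG : NondecreasingInEach G) (y d : Fin m → ℝ≥0)
    (s : Finset (Fin m)) : G y ≤ G (y + ∑ i ∈ s, Pi.single i (d i)) := by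
  induction s using Finset.induction_on with
  | empty => simp
  | insert i s hi ih =>
    have e1 : y + ∑ j ∈ insert i s, Pi.single j (d j)
        = y + ∑ j ∈ s, Pi.single j (d j) + Pi.single i (d i) := by
      rw [Finset.sum_insert hi]; abel
    rw [e1]
    exact ih.trans (hG _ _ _)

theorem NondecreasingInEach.monotone (hG : NondecreasingInEach G) : Monotone G := by
  intro a b hab
  have := hG.le_add_sum a (b - a) Finset.univ
  rwa [Finset.univ_sum_single, add_tsub_cancel_of_le hab] at this

theorem Supermodular.single_sum (hG : Supermodular G) (y d : Fin m → ℝ≥0) (i : Fin m) (h : ℝ≥0)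
    (s : Finset (Fin m)) (hi : i ∉ s) :
    G (y + Pi.single i h) + G (y + ∑ j ∈ s, Pi.single j (d j))
      ≤ G (y + Pi.single i h + ∑ j ∈ s, Pi.single j (d j)) + G y := by
  induction s using Finset.induction_on with
  | empty => simp
  | insert j s hj ih =>
    rw [Finset.mem_insert, not_or] at hi
    have h1 := ih hi.2
    have h2 := hG (y + ∑ j ∈ s, Pi.single j (d j)) h (d j) i j hi.1
    rw [Finset.sum_insert hj]
    have e1 : y + (Pi.single j (d j) + ∑ j ∈ s, Pi.single j (d j))
      = y + ∑ j ∈ s, Pi.single j (d j) + Pi.single j (d j) := by abel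
    have e2 : y + Pi.single i h + (Pi.single j (d j) + ∑ j ∈ s, Pi.single j (d j))
      = y + ∑ j ∈ s, Pi.single j (d j) + Pi.single i h + Pi.single j (d j) := by abel
    have e3 : y + Pi.single i h + ∑ j ∈ s, Pi.single j (d j)
      = y + ∑ j ∈ s, Pi.single j (d j) + Pi.single i h := by abel
    rw [e3] at h1
    rw [e1, e2]
    rw [← NNReal.coe_le_coe] at h1 h2 ⊢
    push_cast at *
    linarith

/-- Telescoping the two-coordinate inequality: increments in disjoint blocks of coordinates interact
as increments in two distinct coordinates do. -/
theorem Supermodular.sum_sum (hG : Supermodular G) (y c d : Fin m → ℝ≥0)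
    (r s : Finset (Fin m)) (hrs : Disjoint r s) :
    G (y + ∑ j ∈ r, Pi.single j (c j)) + G (y + ∑ j ∈ s, Pi.single j (d j))
      ≤ G (y + ∑ j ∈ r, Pi.single j (c j) + ∑ j ∈ s, Pi.single j (d j)) + G y := by
  induction r using Finset.induction_on with
  | empty => simp [add_comm]
  | insert i r hi ih =>
    rw [Finset.disjoint_insert_left] at hrs
    have h1 := ih hrs.2
    have h2 := hG.single_sum (y + ∑ j ∈ r, Pi.single j (c j)) d i (c i) s hrs.1
    rw [Finset.sum_insert hi]
    have e1 : y + (Pi.single i (c i) + ∑ j ∈ r, Pi.single j (c j))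
      = y + ∑ j ∈ r, Pi.single j (c j) + Pi.single i (c i) := by abel
    rw [e1]
    rw [← NNReal.coe_le_coe] at h1 h2 ⊢
    push_cast at *
    linarith

theorem Supermodular.le_sup_add_inf (hG : Supermodular G) (a b : Fin m → ℝ≥0) :
    G a + G b ≤ G (a ⊔ b) + G (a ⊓ b) := by
  classical
  -- From the meet, `a` is reached by raising only coordinates where `b i < a i`, and `b` by raising
  -- only the others; doing both gives the join.
  have key := hG.sum_sum (a ⊓ b) (a - a ⊓ b) (b - a ⊓ b) (Finset.univ.filter fun i => b i < a i)
    (Finset.univ.filter fun i => ¬ b i < a i) (Finset.disjoint_filter_filter_not _ _ _)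
  have hs : ∀ (P : Fin m → Prop) [DecidablePred P] (f : Fin m → ℝ≥0) (i : Fin m),
      (∑ j ∈ Finset.univ.filter P, Pi.single j (f j)) i = if P i then f i else 0 := by
    intro P _ f i
    rw [Finset.sum_filter, Finset.sum_apply,
      Finset.sum_eq_single i (by intro j _ hj; split_ifs <;> simp [hj.symm]) (by simp)]
    split_ifs <;> simp
  convert key using 3 <;> [skip; skip; congr 1] <;> ext1 i <;>
    simp only [Pi.add_apply, hs, Pi.sub_apply, Pi.inf_apply, Pi.sup_apply] <;>
    rcases lt_or_ge (b i) (a i) with h | h <;>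
    simp [h, le_of_lt, not_lt.mpr, inf_of_le_left, inf_of_le_right, sup_of_le_left, sup_of_le_right,
      add_tsub_cancel_of_le]

end Supermodular

/-! ### The four-point inequality and part (a) -/

section FourPoint

/-- The form equals half of `(v + w)(A + B)(C + D) + (v - w)(A - B)(C - D)`, and both coefficients
are nonnegative. Sums increase by hypothesis, and `|A - B| ≤ A' - B'` because `A` and `B` lie
between `B'` and `A'`. -/
theorem four_point {A B A' B' C D C' D' v w : ℝ} (hw : w ≤ v) (hw0 : 0 ≤ w)
    (hA : A ≤ A') (hB : B ≤ A') (hA' : B' ≤ A) (hB' : B' ≤ B) (hAB : A + B ≤ A' + B')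
    (hC : C ≤ C') (hD : D ≤ C') (hC' : D' ≤ C) (hD' : D' ≤ D) (hCD : C + D ≤ C' + D')
    (hB0 : 0 ≤ B') (hD0 : 0 ≤ D') :
    v * (A * C + B * D) + w * (A * D + B * C)
      ≤ v * (A' * C' + B' * D') + w * (A' * D' + B' * C') := by
  have h1 : (A + B) * (C + D) ≤ (A' + B') * (C' + D') :=
    mul_le_mul hAB hCD (by linarith) (by linarith)
  have h2 : (A - B) * (C - D) ≤ (A' - B') * (C' - D') := by
    have hab : |A - B| ≤ A' - B' := abs_le.mpr ⟨by linarith, by linarith⟩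
    have hcd : |C - D| ≤ C' - D' := abs_le.mpr ⟨by linarith, by linarith⟩
    calc (A - B) * (C - D) ≤ |A - B| * |C - D| := by rw [← abs_mul]; exact le_abs_self _
      _ ≤ _ := mul_le_mul hab hcd (abs_nonneg _) (by linarith)
  nlinarith [mul_le_mul_of_nonneg_left h1 (by linarith : 0 ≤ v + w),
    mul_le_mul_of_nonneg_left h2 (by linarith : 0 ≤ v - w)]

variable {N : ℕ} {e : EuclideanSpace ℝ (Fin N)} {t : ℝ}

theorem four_point_polarized (he : ‖e‖ = 1) {V : ℝ≥0 → ℝ≥0}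
    (hV : ∀ r s : ℝ≥0, 0 < r → r ≤ s → V s ≤ V r)
    {F F' : EuclideanSpace ℝ (Fin N) → ℝ≥0}
    (h : ∀ x ∈ halfSpace e t, F x ≤ F' x ∧ F (reflect e t x) ≤ F' x ∧
      F' (reflect e t x) ≤ F x ∧ F' (reflect e t x) ≤ F (reflect e t x) ∧
      F x + F (reflect e t x) ≤ F' x + F' (reflect e t x))
    {x y : EuclideanSpace ℝ (Fin N)} (hx : x ∈ halfSpace e t) (hy : y ∈ halfSpace e t)
    (hxy : x ≠ y) :
    F x * V ‖x - y‖₊ * F y + F (reflect e t x) * V ‖reflect e t x - y‖₊ * F y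
      + (F x * V ‖x - reflect e t y‖₊ * F (reflect e t y)
      + F (reflect e t x) * V ‖reflect e t x - reflect e t y‖₊ * F (reflect e t y))
    ≤ F' x * V ‖x - y‖₊ * F' y + F' (reflect e t x) * V ‖reflect e t x - y‖₊ * F' y
      + (F' x * V ‖x - reflect e t y‖₊ * F' (reflect e t y)
      + F' (reflect e t x) * V ‖reflect e t x - reflect e t y‖₊ * F' (reflect e t y)) := by
  have e1 : ‖reflect e t x - reflect e t y‖₊ = ‖x - y‖₊ :=
    NNReal.eq (norm_reflect_sub_reflect he x y)
  have e2 : ‖reflect e t x - y‖₊ = ‖x - reflect e t y‖₊ := NNReal.eq (norm_reflect_sub he x y)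
  have hle : ‖x - y‖₊ ≤ ‖x - reflect e t y‖₊ := by
    rw [← NNReal.coe_le_coe, coe_nnnorm, coe_nnnorm,
      ← sq_le_sq₀ (norm_nonneg _) (norm_nonneg _), norm_sub_reflect_sq he]
    simp only [halfSpace, Set.mem_ofPred_eq] at hx hy
    nlinarith [mul_nonneg (sub_nonneg.mpr hx) (sub_nonneg.mpr hy)]
  have hvw := hV _ _ (nnnorm_pos.mpr (sub_ne_zero.mpr hxy)) hle
  rw [e1, e2]
  obtain ⟨a1, a2, a3, a4, a5⟩ := h x hx
  obtain ⟨b1, b2, b3, b4, b5⟩ := h y hy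
  have key := four_point (NNReal.coe_le_coe.mpr hvw) (NNReal.coe_nonneg _)
    (NNReal.coe_le_coe.mpr a1) (NNReal.coe_le_coe.mpr a2) (NNReal.coe_le_coe.mpr a3)
    (NNReal.coe_le_coe.mpr a4) (by exact_mod_cast a5)
    (NNReal.coe_le_coe.mpr b1) (NNReal.coe_le_coe.mpr b2) (NNReal.coe_le_coe.mpr b3)
    (NNReal.coe_le_coe.mpr b4) (by exact_mod_cast b5) (NNReal.coe_nonneg _) (NNReal.coe_nonneg _)
  rw [← NNReal.coe_le_coe]
  push_cast
  linarith

/-- Symmetrizing over the whole space, at the price of a factor 4, avoids splitting the domain into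
half-spaces. -/
theorem lintegral_lintegral_eq_four (he : ‖e‖ = 1)
    {k : EuclideanSpace ℝ (Fin N) → EuclideanSpace ℝ (Fin N) → ℝ≥0∞}
    (hk : Measurable (Function.uncurry k)) :
    ∫⁻ x, ∫⁻ y, (k x y + k (reflect e t x) y + (k x (reflect e t y)
      + k (reflect e t x) (reflect e t y))) = 4 * ∫⁻ x, ∫⁻ y, k x y := by
  have hr := measurable_reflect (e := e) (t := t)
  have hx : ∀ x, Measurable (k x) := fun x => hk.of_uncurry_left
  have hI : Measurable fun x => ∫⁻ y, k x y := hk.lintegral_prod_right'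
  have h1 : ∀ x, ∫⁻ y, (k x y + k (reflect e t x) y + (k x (reflect e t y)
      + k (reflect e t x) (reflect e t y))) = (2 * ∫⁻ y, k x y) + 2 * ∫⁻ y, k (reflect e t x) y := by
    intro x
    have h2 : Measurable fun y => k x y + k (reflect e t x) y := (hx _).add (hx _)
    have h3 : Measurable fun y => k x (reflect e t y) := (hx _).comp hr
    rw [lintegral_add_left h2, lintegral_add_left (hx _), lintegral_add_left h3, lintegral_comp_reflect he (k x),
      lintegral_comp_reflect he (k (reflect e t x))]
    ring
  simp only [h1]
  have h5 : Measurable fun x => ∫⁻ y, k (reflect e t x) y := hI.comp hr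
  have h4 : Measurable fun x => 2 * ∫⁻ y, k x y := hI.const_mul 2
  rw [lintegral_add_left h4, lintegral_const_mul _ hI,
    lintegral_const_mul _ h5, lintegral_comp_reflect he fun x => ∫⁻ y, k x y,
    ← add_mul]
  norm_num

theorem lintegral_kernel_le (he : ‖e‖ = 1) (hN : 0 < N) {V : ℝ≥0 → ℝ≥0} (hVm : Measurable V)
    (hV : ∀ r s : ℝ≥0, 0 < r → r ≤ s → V s ≤ V r)
    {F F' : EuclideanSpace ℝ (Fin N) → ℝ≥0} (hF : Measurable F) (hF' : Measurable F')
    (h : ∀ x ∈ halfSpace e t, F x ≤ F' x ∧ F (reflect e t x) ≤ F' x ∧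
      F' (reflect e t x) ≤ F x ∧ F' (reflect e t x) ≤ F (reflect e t x) ∧
      F x + F (reflect e t x) ≤ F' x + F' (reflect e t x)) :
    ∫⁻ x, ∫⁻ y, ((F x * V ‖x - y‖₊ * F y : ℝ≥0) : ℝ≥0∞)
      ≤ ∫⁻ x, ∫⁻ y, ((F' x * V ‖x - y‖₊ * F' y : ℝ≥0) : ℝ≥0∞) := by
  have : Nonempty (Fin N) := ⟨⟨0, hN⟩⟩
  have hm : ∀ f : EuclideanSpace ℝ (Fin N) → ℝ≥0, Measurable f → Measurable (Function.uncurry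
      fun x y => ((f x * V ‖x - y‖₊ * f y : ℝ≥0) : ℝ≥0∞)) := by
    intro f hf
    unfold Function.uncurry
    fun_prop
  rw [← ENNReal.mul_le_mul_iff_right (a := 4) (by norm_num) (by norm_num),
    ← lintegral_lintegral_eq_four (t := t) he (hm F hF),
    ← lintegral_lintegral_eq_four (t := t) he (hm F' hF')]
  refine lintegral_mono fun x => lintegral_mono_ae ?_
  -- `V` is monotone only away from `0`, so the pairs with `y = x` or `y = x_H` are dropped; they
  -- are null since `N > 0`.
  have h0 : ∀ a : EuclideanSpace ℝ (Fin N), ∀ᵐ y : EuclideanSpace ℝ (Fin N), y ≠ a := by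
    simp [ae_iff]
  filter_upwards [h0 x, h0 (reflect e t x)] with y hy hy'
  simp only [← ENNReal.coe_add, ENNReal.coe_le_coe]
  -- The four-term sum is invariant under reflecting either variable, so both may be moved into the
  -- half-space.
  by_cases hx : x ∈ halfSpace e t <;> by_cases hyH : y ∈ halfSpace e t
  · exact four_point_polarized he hV h hx hyH hy.symm
  · have := four_point_polarized he hV h hx (reflect_mem_halfSpace he hyH)
      (fun hh => hy' (by rw [hh, reflect_reflect he]))
    simp only [reflect_reflect he] at this
    rw [← NNReal.coe_le_coe] at this ⊢
    push_cast at *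
    linarith
  · have := four_point_polarized he hV h (reflect_mem_halfSpace he hx) hyH hy'.symm
    simp only [reflect_reflect he] at this
    rw [← NNReal.coe_le_coe] at this ⊢
    push_cast at *
    linarith
  · have := four_point_polarized he hV h (reflect_mem_halfSpace he hx)
      (reflect_mem_halfSpace he hyH)
      (fun hh => hy (by rw [← reflect_reflect (t := t) he y, ← hh, reflect_reflect he]))
    simp only [reflect_reflect he] at this
    rw [← NNReal.coe_le_coe] at this ⊢
    push_cast at *
    linarith

theorem Q_congr_ae {m : ℕ} (G : (Fin m → ℝ≥0) → ℝ≥0) (V : ℝ≥0 → ℝ≥0)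
    {U W : Fin m → EuclideanSpace ℝ (Fin N) → ℝ≥0} (h : ∀ i, U i =ᵐ[volume] W i) :
    Q G V U = Q G V W := by
  have h' : ∀ᵐ x, ∀ i, U i x = W i x := ae_all_iff.mpr h
  refine lintegral_congr_ae ?_
  filter_upwards [h'] with x hx
  refine lintegral_congr_ae ?_
  filter_upwards [h'] with y hy
  simp only [hx, hy]

theorem Q_le_Q_polarize_of_measurable {m : ℕ} (hN : 0 < N) (he : ‖e‖ = 1)
    {G : (Fin m → ℝ≥0) → ℝ≥0}
    (hG : Continuous G) (hmono : NondecreasingInEach G) (hsuper : Supermodular G)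
    {V : ℝ≥0 → ℝ≥0} (hVm : Measurable V) (hV : ∀ r s : ℝ≥0, 0 < r → r ≤ s → V s ≤ V r)
    {U : Fin m → EuclideanSpace ℝ (Fin N) → ℝ≥0} (hU : ∀ i, Measurable (U i)) :
    Q G V U ≤ Q G V (fun i => polarize e t (U i)) := by
  refine lintegral_kernel_le (t := t) he hN hVm hV (F := fun x => G fun i => U i x)
    (F' := fun x => G fun i => polarize e t (U i) x)
    (hG.measurable.comp (measurable_pi_lambda _ hU))
    (hG.measurable.comp (measurable_pi_lambda _ fun i => measurable_polarize (hU i))) ?_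
  intro x hx
  have e1 : (fun i => polarize e t (U i) x)
      = (fun i => U i x) ⊔ (fun i => U i (reflect e t x)) :=
    funext fun i => polarize_of_mem hx
  have e2 : (fun i => polarize e t (U i) (reflect e t x))
      = (fun i => U i x) ⊓ (fun i => U i (reflect e t x)) :=
    funext fun i => polarize_reflect he hx
  rw [e1, e2]
  exact ⟨hmono.monotone le_sup_left, hmono.monotone le_sup_right, hmono.monotone inf_le_left,
    hmono.monotone inf_le_right, hsuper.le_sup_add_inf _ _⟩

theorem Q_le_Q_polarize {m : ℕ} (hN : 0 < N) (he : ‖e‖ = 1) {G : (Fin m → ℝ≥0) → ℝ≥0}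
    (hG : Continuous G) (hmono : NondecreasingInEach G) (hsuper : Supermodular G)
    {V : ℝ≥0 → ℝ≥0} (hVm : Measurable V) (hV : ∀ r s : ℝ≥0, 0 < r → r ≤ s → V s ≤ V r)
    {U : Fin m → EuclideanSpace ℝ (Fin N) → ℝ≥0} (hU : ∀ i, AEMeasurable (U i)) :
    Q G V U ≤ Q G V (fun i => polarize e t (U i)) := by
  rw [Q_congr_ae G V fun i => (hU i).ae_eq_mk,
    Q_congr_ae G V fun i => polarize_congr_ae he (hU i).ae_eq_mk]
  exact Q_le_Q_polarize_of_measurable hN he hG hmono hsuper hVm hV fun i => (hU i).measurable_mk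

end FourPoint

/-! ### Polarization of superlevel sets -/

section SetPolarization

variable {N : ℕ} {e : EuclideanSpace ℝ (Fin N)} {t : ℝ}

/-- Polarization of a set with respect to the half-space `halfSpace e t`. -/
def polarizeSet (e : EuclideanSpace ℝ (Fin N)) (t : ℝ) (A : Set (EuclideanSpace ℝ (Fin N))) :
    Set (EuclideanSpace ℝ (Fin N)) :=
  {x | (x ∈ halfSpace e t ∧ (x ∈ A ∨ reflect e t x ∈ A)) ∨ (x ∈ A ∧ reflect e t x ∈ A)}

theorem superlevel_polarize (u : EuclideanSpace ℝ (Fin N) → ℝ≥0) (s : ℝ≥0) :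
    {x | s ≤ polarize e t u x} = polarizeSet e t {x | s ≤ u x} := by
  ext x
  by_cases hx : x ∈ halfSpace e t
  · simp only [Set.mem_ofPred_eq, polarize_of_mem hx, le_max_iff, polarizeSet, hx, true_and]
    tauto
  · simp only [Set.mem_ofPred_eq, polarize_of_notMem hx, le_min_iff, polarizeSet, hx, false_and,
      false_or]

theorem measurableSet_polarizeSet {A : Set (EuclideanSpace ℝ (Fin N))} (hA : MeasurableSet A) :
    MeasurableSet (polarizeSet e t A) :=
  (measurableSet_halfSpace.inter (hA.union (measurable_reflect hA))).union
    (hA.inter (measurable_reflect hA))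

/-- The points gained are exactly the mirror images of the points lost; hence volume is preserved.
-/
theorem polarizeSet_sdiff (he : ‖e‖ = 1) (A : Set (EuclideanSpace ℝ (Fin N))) :
    polarizeSet e t A \ A = reflect e t ⁻¹' (A \ polarizeSet e t A) := by
  ext x
  have h1 := reflect_mem_halfSpace (t := t) he (x := x)
  have h2 := reflect_eq_self (t := t) he (x := x)
  simp only [polarizeSet, Set.mem_sdiff, Set.mem_ofPred_eq, Set.mem_preimage, reflect_reflect he]
  by_cases hx : x ∈ halfSpace e t <;> by_cases hx' : reflect e t x ∈ halfSpace e t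
  · rw [h2 hx hx']; tauto
  all_goals tauto

theorem volume_polarizeSet (he : ‖e‖ = 1) {A : Set (EuclideanSpace ℝ (Fin N))}
    (hA : MeasurableSet A) : volume (polarizeSet e t A) = volume A := by
  rw [← measure_inter_add_sdiff (polarizeSet e t A) hA, polarizeSet_sdiff he,
    measure_preimage_reflect he, Set.inter_comm,
    measure_inter_add_sdiff A (measurableSet_polarizeSet hA)]

theorem norm_le_norm_reflect (he : ‖e‖ = 1) (ht : t ≤ 0) {x : EuclideanSpace ℝ (Fin N)}
    (hx : x ∈ halfSpace e t) : ‖x‖ ≤ ‖reflect e t x‖ := by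
  rw [← sq_le_sq₀ (norm_nonneg _) (norm_nonneg _), norm_reflect_sq he]
  simp only [halfSpace, Set.mem_ofPred_eq] at hx
  nlinarith [mul_nonneg (neg_nonneg.mpr ht) (sub_nonneg.mpr hx)]

theorem polarizeSet_subset_ball (he : ‖e‖ = 1) (ht : t ≤ 0)
    {A : Set (EuclideanSpace ℝ (Fin N))} {R : ℝ} (hA : A ⊆ Metric.ball 0 R) :
    polarizeSet e t A ⊆ Metric.ball 0 R := by
  rintro x (⟨hx, h | h⟩ | h)
  · exact hA h
  · have := hA h
    rw [mem_ball_zero_iff] at this ⊢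
    exact (norm_le_norm_reflect he ht hx).trans_lt this
  · exact hA h.1

/-- Since `t ≤ 0`, points of the half-space are no farther from the origin than their images. Thus a
point gained outside the ball has its image in `A`, also outside the ball. A point of `A` outside
the ball whose image lies in the ball but not in `A` is lost, which is the strict gain. -/
theorem volume_polarizeSet_sdiff_ball_add_le (he : ‖e‖ = 1) (ht : t ≤ 0)
    {A : Set (EuclideanSpace ℝ (Fin N))} (hA : MeasurableSet A) (r : ℝ) :
    volume (polarizeSet e t A \ Metric.ball 0 r)
      + volume ((A \ Metric.ball 0 r) ∩ reflect e t ⁻¹' (Metric.ball 0 r \ A))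
      ≤ volume (A \ Metric.ball 0 r) := by
  set B : Set (EuclideanSpace ℝ (Fin N)) := Metric.ball 0 r with hB
  have hBm : MeasurableSet B := measurableSet_ball
  have hP := measurableSet_polarizeSet (e := e) (t := t) hA
  set P := polarizeSet e t A with hPdef
  set E := (A \ B) ∩ reflect e t ⁻¹' (B \ A) with hE
  have hEm : MeasurableSet E := (hA.diff hBm).inter (measurable_reflect (hBm.diff hA))
  have hmem : ∀ x, ‖reflect e t x‖ < ‖x‖ → x ∉ halfSpace e t := fun x h hx =>
    absurd (norm_le_norm_reflect he ht hx) (not_le.mpr h)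
  have hBr : ∀ x ∈ halfSpace e t, reflect e t x ∈ B → x ∈ B := by
    intro x hx h
    rw [hB, mem_ball_zero_iff] at *
    exact (norm_le_norm_reflect he ht hx).trans_lt h
  have hEH : ∀ x ∈ E, x ∉ halfSpace e t := fun x hx hH => hx.1.2 (hBr x hH hx.2.1)
  rw [← measure_inter_add_sdiff (P \ B) hA,
    ← measure_preimage_reflect (t := t) he ((P \ B) \ A)]
  have hPBA : MeasurableSet (reflect e t ⁻¹' ((P \ B) \ A)) :=
    measurable_reflect ((hP.diff hBm).diff hA)
  have hrm := fun x => reflect_mem_halfSpace (t := t) he (x := x)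
  have hrs := fun x => reflect_eq_self (t := t) he (x := x)
  -- After reflecting the gained points back, the three pieces are disjoint subsets of `A \ B`.
  have hd1 : Disjoint (P \ B ∩ A) (reflect e t ⁻¹' ((P \ B) \ A)) := by
    rw [Set.disjoint_left]
    rintro x ⟨⟨hxP, hxB⟩, hxA⟩ ⟨⟨hyP, hyB⟩, hyA⟩
    simp only [hPdef, polarizeSet, Set.mem_ofPred_eq, reflect_reflect he] at hxP hyP
    have h2 := hrs x
    by_cases hx : x ∈ halfSpace e t <;> by_cases hx' : reflect e t x ∈ halfSpace e t
    · rw [h2 hx hx'] at hyA; exact hyA hxA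
    all_goals tauto
  have hd2 : Disjoint ((P \ B ∩ A) ∪ reflect e t ⁻¹' ((P \ B) \ A)) E := by
    rw [Set.disjoint_left]
    rintro x (⟨⟨hxP, hxB⟩, hxA⟩ | ⟨⟨hyP, hyB⟩, hyA⟩) hxE
    · have h1 := hEH x hxE
      simp only [hPdef, polarizeSet, Set.mem_ofPred_eq] at hxP
      have h3 : reflect e t x ∉ A := hxE.2.2
      tauto
    · exact hyB hxE.2.1
  rw [← measure_union hd1 hPBA, ← measure_union hd2 hEm]
  refine measure_mono ?_
  rintro x ((⟨⟨hxP, hxB⟩, hxA⟩ | ⟨⟨hyP, hyB⟩, hyA⟩) | hxE)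
  · exact ⟨hxA, hxB⟩
  · simp only [hPdef, polarizeSet, Set.mem_ofPred_eq, reflect_reflect he] at hyP
    have hH : reflect e t x ∈ halfSpace e t := by tauto
    refine ⟨by tauto, fun hxB => hyB (hBr _ hH ?_)⟩
    rwa [reflect_reflect he]
  · exact hxE.1

end SetPolarization

/-! ### Polar coordinates -/

section Averaging

variable {N : ℕ}

theorem lintegral_polar (hN : 0 < N) {f : EuclideanSpace ℝ (Fin N) → ℝ≥0∞} (hf : Measurable f) :
    ∫⁻ w, f w = ∫⁻ e : Metric.sphere (0 : EuclideanSpace ℝ (Fin N)) 1, ∫⁻ s in Set.Ioi (0 : ℝ),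
      ENNReal.ofReal (s ^ (N - 1)) * f (s • e.1)
      ∂volume ∂(volume : Measure (EuclideanSpace ℝ (Fin N))).toSphere := by
  have : Nonempty (Fin N) := ⟨⟨0, hN⟩⟩
  have hmp := (volume : Measure (EuclideanSpace ℝ (Fin N))).measurePreserving_homeomorphUnitSphereProd
  have h1 := hmp.lintegral_comp_emb (Homeomorph.measurableEmbedding _)
    (fun z => f (z.2.1 • z.1.1))
  have h2 : ∫⁻ w, f w = ∫⁻ w : ({0}ᶜ : Set (EuclideanSpace ℝ (Fin N))), f w.1
      ∂(volume : Measure (EuclideanSpace ℝ (Fin N))).comap (↑) := by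
    rw [lintegral_subtype_comap (measurableSet_singleton _).compl f,
      restrict_compl_singleton]
  have hm : Measurable fun z : Metric.sphere (0 : EuclideanSpace ℝ (Fin N)) 1 × Set.Ioi (0 : ℝ) =>
      f (z.2.1 • z.1.1) := by fun_prop
  have h3 : ∀ w : ({0}ᶜ : Set (EuclideanSpace ℝ (Fin N))),
      f (((homeomorphUnitSphereProd _ w).2.1) • (homeomorphUnitSphereProd _ w).1.1) = f w.1 := by
    intro w
    congr 1
    have := (homeomorphUnitSphereProd (EuclideanSpace ℝ (Fin N))).symm_apply_apply w
    exact congrArg Subtype.val this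
  simp only [h3] at h1
  rw [h2, h1, lintegral_prod _ hm.aemeasurable]
  refine lintegral_congr fun e => ?_
  rw [Measure.volumeIoiPow, lintegral_withDensity_eq_lintegral_mul _ (by fun_prop)
    (by fun_prop)]
  rw [← lintegral_subtype_comap measurableSet_Ioi
    (fun s : ℝ => ENNReal.ofReal (s ^ (N - 1)) * f (s • e.1))]
  simp [finrank_euclideanSpace]

end Averaging

/-! ### Averaging over translations and reflections -/

section Averaging

variable {N : ℕ}

theorem lintegral_comp_two_mul_sub (f : ℝ → ℝ≥0∞) (hf : Measurable f) (a : ℝ) :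
    ∫⁻ s, f s = 2 * ∫⁻ t, f (2 * (t - a)) := by
  have h1 : ∫⁻ t, f (2 * (t - a)) = ∫⁻ t, f (2 * t) :=
    lintegral_sub_right_eq_self (fun t => f (2 * t)) a
  have h2 : ∫⁻ t, f (2 * t) = ∫⁻ t, f t ∂(Measure.map (2 * ·) (volume : Measure ℝ)) :=
    (lintegral_map hf (by fun_prop)).symm
  rw [h1, h2, Real.map_volume_mul_left two_ne_zero, lintegral_smul_measure, smul_eq_mul, ← mul_assoc]
  have : (2 : ℝ≥0∞) * ENNReal.ofReal |(2 : ℝ)⁻¹| = 1 := by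
    rw [← ENNReal.ofReal_ofNat, ← ENNReal.ofReal_mul (by norm_num)]
    norm_num
  rw [this, one_mul]

theorem lintegral_volume_translate {A B : Set (EuclideanSpace ℝ (Fin N))}
    (hA : MeasurableSet A) (hB : MeasurableSet B) :
    ∫⁻ w, volume (A ∩ (fun x => x + w) ⁻¹' B) = volume A * volume B := by
  let S : Set (EuclideanSpace ℝ (Fin N) × EuclideanSpace ℝ (Fin N)) :=
    {z | z.2 ∈ A ∧ z.2 + z.1 ∈ B}
  have hS : MeasurableSet S :=
    (measurable_snd hA).inter ((measurable_snd.add measurable_fst) hB)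
  have h1 := Measure.prod_apply (μ := volume) (ν := volume) hS
  have h2 := Measure.prod_apply_symm (μ := volume) (ν := volume) hS
  rw [h1] at h2
  refine h2.trans ?_
  have h3 : ∀ y : EuclideanSpace ℝ (Fin N),
      volume ((fun x => (x, y)) ⁻¹' S) = A.indicator (fun _ => volume B) y := by
    intro y
    by_cases hy : y ∈ A
    · rw [Set.indicator_of_mem hy, ← measure_preimage_add volume y B]
      congr 1
      ext x
      simp [S, hy]
    · simp [S, hy]
  simp only [h3]
  rw [lintegral_indicator hA, lintegral_const, Measure.restrict_apply_univ, mul_comm]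

/-- A translation of `x` by `s • e` is also the reflection of `x` at level `t`, where `s = 2 * (t -
inner ℝ x e)`. Translations along `e` can therefore be traded for reflections, with Jacobian 2. -/
theorem lintegral_volume_line_le {R : ℝ} {A B : Set (EuclideanSpace ℝ (Fin N))}
    (hA : MeasurableSet A) (hB : MeasurableSet B) (hAR : A ⊆ Metric.ball 0 R)
    (hAB : ∀ x ∈ A, ∀ y ∈ B, ‖y‖ < ‖x‖) {e : EuclideanSpace ℝ (Fin N)} (he : ‖e‖ = 1)
    {η : ℝ≥0∞} (hη : ∀ t ≤ 0, volume (A ∩ reflect e t ⁻¹' B) ≤ η) :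
    ∫⁻ s in Set.Ioi (0 : ℝ), volume (A ∩ (fun x => x + s • e) ⁻¹' B)
      ≤ 2 * (η * ENNReal.ofReal R) := by
  let S : Set (ℝ × EuclideanSpace ℝ (Fin N)) := {z | 0 < z.1 ∧ z.2 ∈ A ∧ z.2 + z.1 • e ∈ B}
  have hS : MeasurableSet S :=
    (measurableSet_lt measurable_const measurable_fst).inter ((measurable_snd hA).inter
      ((measurable_snd.add (measurable_fst.smul_const e)) hB))
  let T : Set (ℝ × EuclideanSpace ℝ (Fin N)) :=
    {z | z.1 ∈ Set.Icc (-R) 0 ∧ z.2 ∈ A ∧ reflect e z.1 z.2 ∈ B}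
  have hT : MeasurableSet T :=
    (measurable_fst measurableSet_Icc).inter ((measurable_snd hA).inter
      (measurable_reflect_uncurry hB))
  calc ∫⁻ s in Set.Ioi (0 : ℝ), volume (A ∩ (fun x => x + s • e) ⁻¹' B)
      = ∫⁻ s, volume (Prod.mk s ⁻¹' S) := by
        rw [← lintegral_indicator measurableSet_Ioi]
        refine lintegral_congr fun s => ?_
        by_cases hs : 0 < s
        · rw [Set.indicator_of_mem (Set.mem_Ioi.mpr hs)]
          congr 1
          ext x
          simp [S, hs]
        · rw [Set.indicator_of_notMem (by simpa using hs)]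
          simp [S, hs]
    _ = ∫⁻ x, volume ((fun s => (s, x)) ⁻¹' S) := by
        rw [← Measure.prod_apply hS, Measure.prod_apply_symm hS]
    _ ≤ ∫⁻ x, 2 * volume ((fun s => (s, x)) ⁻¹' T) := by
        refine lintegral_mono fun x => ?_
        have hSx : MeasurableSet ((fun s => (s, x)) ⁻¹' S) := measurable_prodMk_right hS
        have hTx : MeasurableSet ((fun s => (s, x)) ⁻¹' T) := measurable_prodMk_right hT
        rw [← lintegral_indicator_one hSx, ← lintegral_indicator_one hTx,
          lintegral_comp_two_mul_sub _ (measurable_one.indicator hSx) (inner ℝ x e)]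
        gcongr with t
        by_cases hs : 2 * (t - inner ℝ x e) ∈ (fun s => (s, x)) ⁻¹' S
        · have hmem : t ∈ (fun s => (s, x)) ⁻¹' T := by
            obtain ⟨h1, h2, h3⟩ := hs
            simp only at h1 h2 h3
            change x + (2 * (t - inner ℝ x e)) • e ∈ B at h3
            -- Since `s > 0` and the image is closer to the origin, `t ≤ 0`; and `t > inner ℝ x e >
            -- -R`. Only levels in an interval of length `R` contribute.
            have h4 : ‖reflect e t x‖ < ‖x‖ := hAB x h2 _ h3
            have h5 := norm_reflect_sq (t := t) he x
            have h6 : ‖reflect e t x‖ ^ 2 < ‖x‖ ^ 2 :=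
              pow_lt_pow_left₀ h4 (norm_nonneg _) two_ne_zero
            have h7 : |inner ℝ x e| ≤ ‖x‖ := by
              simpa [he] using abs_real_inner_le_norm x e
            have h8 := mem_ball_zero_iff.mp (hAR h2)
            refine ⟨⟨by linarith [neg_abs_le (inner ℝ x e)], ?_⟩, h2, h3⟩
            change t ≤ 0
            by_contra! h9
            nlinarith
          rw [Set.indicator_of_mem hmem]
          exact Set.indicator_le_self' (fun _ _ => zero_le) _
        · rw [Set.indicator_of_notMem hs]
          exact zero_le
    _ = 2 * ∫⁻ t, volume (Prod.mk t ⁻¹' T) := by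
        rw [lintegral_const_mul _ (measurable_measure_prodMk_right hT),
          ← Measure.prod_apply_symm hT, Measure.prod_apply hT]
    _ ≤ 2 * (η * ENNReal.ofReal R) := by
        gcongr
        calc ∫⁻ t, volume (Prod.mk t ⁻¹' T)
            ≤ ∫⁻ t, (Set.Icc (-R) 0).indicator (fun _ => η) t := by
              refine lintegral_mono fun t => ?_
              by_cases ht : t ∈ Set.Icc (-R) 0
              · rw [Set.indicator_of_mem ht]
                refine le_trans (measure_mono ?_) (hη t ht.2)
                exact fun x hx => hx.2
              · have : Prod.mk t ⁻¹' T = ∅ := by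
                  ext x
                  simp only [T, Set.mem_preimage, Set.mem_ofPred_eq, ht, false_and,
                    Set.mem_empty_iff_false]
                rw [this, measure_empty]
                exact zero_le
          _ = η * ENNReal.ofReal R := by
              rw [lintegral_indicator measurableSet_Icc, lintegral_const,
                Measure.restrict_apply_univ, Real.volume_Icc]
              simp

/-- If `A` lies farther from the origin than `B`, some reflection moving points of `A` towards the
origin sends a definite portion of `A` into `B`. -/
theorem exists_reflect_overlap (hN : 0 < N) (R : ℝ) {δ : ℝ≥0∞} (hδ : δ ≠ 0) :
    ∃ η : ℝ≥0∞, 0 < η ∧ ∀ A B : Set (EuclideanSpace ℝ (Fin N)), MeasurableSet A → MeasurableSet B →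
      A ⊆ Metric.ball 0 R → B ⊆ Metric.ball 0 R → (∀ x ∈ A, ∀ y ∈ B, ‖y‖ < ‖x‖) →
      δ ≤ volume A → δ ≤ volume B →
      ∃ (e : EuclideanSpace ℝ (Fin N)) (t : ℝ), ‖e‖ = 1 ∧ t ≤ 0 ∧
        η ≤ volume (A ∩ reflect e t ⁻¹' B) := by
  set σ := (volume : Measure (EuclideanSpace ℝ (Fin N))).toSphere with hσ
  set c := ENNReal.ofReal ((2 * R) ^ (N - 1)) with hc
  have hM : c * (2 * ENNReal.ofReal R) * σ Set.univ ≠ ∞ :=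
    ENNReal.mul_ne_top (ENNReal.mul_ne_top ENNReal.ofReal_ne_top
      (ENNReal.mul_ne_top (by norm_num) ENNReal.ofReal_ne_top)) (measure_ne_top _ _)
  -- If every overlap were below `η`, the average would give `δ * δ ≤ η * M`, with `M` depending
  -- only on `N` and `R`; `η` is chosen to forbid this.
  obtain ⟨η, hη, hlt⟩ := ENNReal.exists_nnreal_pos_mul_lt hM (mul_ne_zero hδ hδ)
  refine ⟨η, by exact_mod_cast hη, fun A B hA hB hAR hBR hAB hδA hδB => ?_⟩
  by_contra! hcon
  refine absurd hlt (not_lt.mpr ?_)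
  have hS : MeasurableSet {z : EuclideanSpace ℝ (Fin N) × EuclideanSpace ℝ (Fin N) |
      z.2 ∈ A ∧ z.2 + z.1 ∈ B} :=
    (measurable_snd hA).inter ((measurable_snd.add measurable_fst) hB)
  have hφ : Measurable fun w : EuclideanSpace ℝ (Fin N) =>
      volume (A ∩ (fun x => x + w) ⁻¹' B) := measurable_measure_prodMk_left hS
  calc δ * δ ≤ volume A * volume B := mul_le_mul' hδA hδB
    _ = ∫⁻ e : Metric.sphere (0 : EuclideanSpace ℝ (Fin N)) 1, ∫⁻ s in Set.Ioi (0 : ℝ),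
        ENNReal.ofReal (s ^ (N - 1)) * volume (A ∩ (fun x => x + s • e.1) ⁻¹' B) ∂volume ∂σ := by
        rw [← lintegral_volume_translate hA hB, lintegral_polar hN hφ]
    _ ≤ ∫⁻ e : Metric.sphere (0 : EuclideanSpace ℝ (Fin N)) 1, c * (2 * (η * ENNReal.ofReal R)) ∂σ := by
        refine lintegral_mono fun e => ?_
        have he : ‖e.1‖ = 1 := by simp
        refine le_trans ?_ (mul_le_mul_right (lintegral_volume_line_le hA hB hAR hAB he
          (fun t ht => (hcon e.1 t he ht).le)) c)
        rw [← lintegral_const_mul' _ _ ENNReal.ofReal_ne_top]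
        refine setLIntegral_mono' measurableSet_Ioi fun s hs => ?_
        -- A translation longer than the diameter `2 * R` cannot carry a point of `A` into `B`.
        rcases le_or_gt s (2 * R) with h | h
        · gcongr
          exact (Set.mem_Ioi.mp hs).le
        · have : A ∩ (fun x => x + s • e.1) ⁻¹' B = ∅ := by
            rw [Set.eq_empty_iff_forall_notMem]
            rintro x ⟨hx, hy⟩
            have h1 := mem_ball_zero_iff.mp (hAR hx)
            have h2 := mem_ball_zero_iff.mp (hBR hy)
            have h3 : ‖s • e.1‖ ≤ ‖x + s • e.1‖ + ‖x‖ := by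
              simpa using norm_sub_le (x + s • e.1) x
            rw [norm_smul, he, mul_one, Real.norm_of_nonneg (Set.mem_Ioi.mp hs).le] at h3
            linarith
          rw [this]; simp
    _ = η * (c * (2 * ENNReal.ofReal R) * σ Set.univ) := by
        rw [lintegral_const]; ring

end Averaging

/-! ### Rearrangement inequality for finitely valued functions -/

section Grid

variable {N m : ℕ}

/-- The radial function with values in the finite set `S` whose superlevel set at the level `s ∈ S`
is the ball of volume `v s`. -/
noncomputable def radialGrid (S : Finset ℝ≥0) (v : ℝ≥0 → ℝ≥0∞) (x : EuclideanSpace ℝ (Fin N)) :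
    ℝ≥0 :=
  S.sup fun s => open Classical in
    if volume (Metric.ball (0 : EuclideanSpace ℝ (Fin N)) ‖x‖) < v s then s else 0

theorem le_radialGrid_iff {S : Finset ℝ≥0} {v : ℝ≥0 → ℝ≥0∞} (hv : Antitone v) {s : ℝ≥0}
    (hs : s ∈ S) (hs0 : 0 < s) {x : EuclideanSpace ℝ (Fin N)} :
    s ≤ radialGrid S v x ↔ volume (Metric.ball (0 : EuclideanSpace ℝ (Fin N)) ‖x‖) < v s := by
  rw [radialGrid, Finset.le_sup_iff (by simpa using hs0)]
  constructor
  · rintro ⟨b, -, h⟩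
    split_ifs at h with hb
    · exact hb.trans_le (hv h)
    · exact absurd h (not_le.mpr hs0)
  · intro h
    exact ⟨s, hs, by rw [if_pos h]⟩

theorem radialGrid_mem {S : Finset ℝ≥0} (h0 : 0 ∈ S) (v : ℝ≥0 → ℝ≥0∞)
    (x : EuclideanSpace ℝ (Fin N)) : radialGrid S v x ∈ S := by
  obtain ⟨s, hs, h⟩ := Finset.exists_mem_eq_sup S ⟨0, h0⟩ fun s => open Classical in
    if volume (Metric.ball (0 : EuclideanSpace ℝ (Fin N)) ‖x‖) < v s then s else 0
  rw [radialGrid, h]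
  split_ifs
  · exact hs
  · exact h0

theorem exists_ball_volume_eq (hN : 0 < N) {a : ℝ≥0∞} (ha : a ≠ ∞) :
    ∃ r : ℝ, {x : EuclideanSpace ℝ (Fin N) |
        volume (Metric.ball (0 : EuclideanSpace ℝ (Fin N)) ‖x‖) < a} = Metric.ball 0 r ∧
      volume (Metric.ball (0 : EuclideanSpace ℝ (Fin N)) r) = a := by
  have : Nonempty (Fin N) := ⟨⟨0, hN⟩⟩
  set c := volume (Metric.ball (0 : EuclideanSpace ℝ (Fin N)) 1) with hc
  have hc0 : c ≠ 0 := (Metric.measure_ball_pos volume _ one_pos).ne'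
  have hct : c ≠ ∞ := measure_ball_lt_top.ne
  have hball : ∀ r : ℝ, 0 ≤ r → volume (Metric.ball (0 : EuclideanSpace ℝ (Fin N)) r)
      = ENNReal.ofReal (r ^ N) * c := by
    intro r hr
    simpa using Measure.addHaar_ball (volume : Measure (EuclideanSpace ℝ (Fin N))) 0 hr
  obtain ⟨r, hr, hra⟩ : ∃ r : ℝ, 0 ≤ r ∧ ENNReal.ofReal (r ^ N) * c = a := by
    refine ⟨(a / c).toReal ^ ((N : ℝ)⁻¹), by positivity, ?_⟩
    rw [Real.rpow_inv_natCast_pow ENNReal.toReal_nonneg hN.ne',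
      ENNReal.ofReal_toReal (ENNReal.div_ne_top ha hc0), ENNReal.div_mul_cancel hc0 hct]
  refine ⟨r, ?_, by rw [hball r hr, hra]⟩
  ext x
  rw [Set.mem_ofPred_eq, hball _ (norm_nonneg x), ← hra, mem_ball_zero_iff,
    ENNReal.mul_lt_mul_iff_left hc0 hct, ENNReal.ofReal_lt_ofReal_iff_of_nonneg (by positivity)]
  exact pow_lt_pow_iff_left₀ (norm_nonneg x) hr hN.ne'

theorem measure_sdiff_comm_of_eq {α : Type*} [MeasurableSpace α] {μ : Measure α} {A B : Set α}
    (hA : MeasurableSet A) (hB : MeasurableSet B) (hAf : μ A ≠ ∞) (h : μ A = μ B) :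
    μ (B \ A) = μ (A \ B) := by
  have h1 := measure_inter_add_sdiff (μ := μ) A hB
  have h2 := measure_inter_add_sdiff (μ := μ) B hA
  rw [← h, ← h1, Set.inter_comm B A] at h2
  exact (ENNReal.add_right_inj (measure_ne_top_of_subset Set.inter_subset_left hAf)).mp h2

/-- `U` takes values in the finite set `S`, and its superlevel sets are contained in a ball of
radius `R` and have the volumes prescribed by `v`. -/
structure IsGrid (S : Finset ℝ≥0) (R : ℝ) (v : Fin m → ℝ≥0 → ℝ≥0∞)
    (U : Fin m → EuclideanSpace ℝ (Fin N) → ℝ≥0) : Prop where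
  measurable : ∀ i, Measurable (U i)
  mem : ∀ i x, U i x ∈ S
  subset : ∀ i s, 0 < s → {x | s ≤ U i x} ⊆ Metric.ball 0 R
  volume_eq : ∀ i s, 0 < s → volume {x | s ≤ U i x} = v i s

theorem IsGrid.measurableSet {S : Finset ℝ≥0} {R : ℝ} {v : Fin m → ℝ≥0 → ℝ≥0∞}
    {U : Fin m → EuclideanSpace ℝ (Fin N) → ℝ≥0} (hU : IsGrid S R v U) (i : Fin m) (s : ℝ≥0) :
    MeasurableSet {x | s ≤ U i x} :=
  measurableSet_le measurable_const (hU.measurable i)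

theorem IsGrid.polarize {S : Finset ℝ≥0} {R : ℝ} {v : Fin m → ℝ≥0 → ℝ≥0∞}
    {U : Fin m → EuclideanSpace ℝ (Fin N) → ℝ≥0} (hU : IsGrid S R v U)
    {e : EuclideanSpace ℝ (Fin N)} {t : ℝ} (he : ‖e‖ = 1) (ht : t ≤ 0) :
    IsGrid S R v fun i => polarize e t (U i) where
  measurable i := measurable_polarize (hU.measurable i)
  mem i x := by
    by_cases hx : x ∈ halfSpace e t
    · rw [polarize_of_mem hx]
      rcases max_choice (U i x) (U i (reflect e t x)) with h | h <;> rw [h] <;> exact hU.mem _ _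
    · rw [polarize_of_notMem hx]
      rcases min_choice (U i x) (U i (reflect e t x)) with h | h <;> rw [h] <;> exact hU.mem _ _
  subset i s hs := by
    rw [superlevel_polarize]
    exact polarizeSet_subset_ball he ht (hU.subset i s hs)
  volume_eq i s hs := by
    rw [superlevel_polarize, volume_polarizeSet he (hU.measurableSet i s), hU.volume_eq i s hs]

/-- The total volume by which the superlevel sets of `U` exceed the balls of radii `r`. -/
noncomputable def excess (S : Finset ℝ≥0) (r : Fin m → ℝ≥0 → ℝ)
    (U : Fin m → EuclideanSpace ℝ (Fin N) → ℝ≥0) : ℝ≥0∞ :=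
  ∑ z ∈ Finset.univ ×ˢ S.filter (0 < ·),
    volume ({x | z.2 ≤ U z.1 x} \ Metric.ball 0 (r z.1 z.2))

/-- By pigeonhole one component and level carries a definite share of the excess. The reflection
chosen for it lowers that term, while no other term increases. The gain `η` is uniform in `U`, as
the infimum argument requires. -/
theorem exists_polarize_excess_lt (hN : 0 < N) {S : Finset ℝ≥0} {R : ℝ}
    {v : Fin m → ℝ≥0 → ℝ≥0∞} {r : Fin m → ℝ≥0 → ℝ}
    (hr : ∀ i s, 0 < s → volume (Metric.ball (0 : EuclideanSpace ℝ (Fin N)) (r i s)) = v i s)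
    {ε : ℝ≥0∞} (hε : ε ≠ 0) :
    ∃ η : ℝ≥0∞, 0 < η ∧ ∀ U : Fin m → EuclideanSpace ℝ (Fin N) → ℝ≥0, IsGrid S R v U →
      ε ≤ excess S r U → ∃ (e : EuclideanSpace ℝ (Fin N)) (t : ℝ), ‖e‖ = 1 ∧ t ≤ 0 ∧
        excess S r (fun i => polarize e t (U i)) + η ≤ excess S r U := by
  have : Nonempty (Fin N) := ⟨⟨0, hN⟩⟩
  obtain ⟨δ, hδ, hlt⟩ := ENNReal.exists_nnreal_pos_mul_lt
    (a := ((Finset.univ ×ˢ S.filter (0 < ·) : Finset (Fin m × ℝ≥0)).card : ℝ≥0∞))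
    (ENNReal.natCast_ne_top _) hε
  obtain ⟨η, hη, H⟩ := exists_reflect_overlap hN R (δ := δ) (by exact_mod_cast hδ.ne')
  refine ⟨η, hη, fun U hU hεU => ?_⟩
  obtain ⟨z, hz, hzδ⟩ : ∃ z ∈ (Finset.univ ×ˢ S.filter (0 < ·) : Finset (Fin m × ℝ≥0)),
      (δ : ℝ≥0∞) < volume ({x | z.2 ≤ U z.1 x} \ Metric.ball 0 (r z.1 z.2)) := by
    by_contra! hcon
    have := Finset.sum_le_card_nsmul _ _ _ hcon
    rw [nsmul_eq_mul, mul_comm] at this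
    exact absurd (hεU.trans this) (not_le.mpr hlt)
  have hz0 : 0 < z.2 := by simpa using (Finset.mem_filter.mp (Finset.mem_product.mp hz).2).2
  have hAm := hU.measurableSet z.1 z.2
  have hAR := hU.subset z.1 z.2 hz0
  have hvol : volume {x | z.2 ≤ U z.1 x}
      = volume (Metric.ball (0 : EuclideanSpace ℝ (Fin N)) (r z.1 z.2)) := by
    rw [hU.volume_eq _ _ hz0, hr _ _ hz0]
  have hfin : volume {x | z.2 ≤ U z.1 x} ≠ ∞ :=
    measure_ne_top_of_subset hAR measure_ball_lt_top.ne
  have hBR : Metric.ball (0 : EuclideanSpace ℝ (Fin N)) (r z.1 z.2) ⊆ Metric.ball 0 R := by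
    by_contra hcon
    have hle : R < r z.1 z.2 := by
      by_contra! h
      exact hcon (Metric.ball_subset_ball h)
    have : {x | z.2 ≤ U z.1 x} \ Metric.ball 0 (r z.1 z.2) = ∅ :=
      Set.sdiff_eq_empty.mpr (hAR.trans (Metric.ball_subset_ball hle.le))
    rw [this, measure_empty] at hzδ
    exact absurd hzδ not_lt_zero
  obtain ⟨e, t, he, ht, hle⟩ := H _ _ (hAm.diff measurableSet_ball)
    (measurableSet_ball.diff hAm) (Set.sdiff_subset.trans hAR) (Set.sdiff_subset.trans hBR)
    (fun x hx y hy => (mem_ball_zero_iff.mp hy.1).trans_le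
      (by simpa using hx.2)) hzδ.le
    (by rw [measure_sdiff_comm_of_eq hAm measurableSet_ball hfin hvol]; exact hzδ.le)
  refine ⟨e, t, he, ht, ?_⟩
  have key : ∀ w : Fin m × ℝ≥0, _ := fun w =>
    volume_polarizeSet_sdiff_ball_add_le he ht (hU.measurableSet w.1 w.2) (r w.1 w.2)
  simp only [excess, superlevel_polarize]
  rw [← Finset.sum_erase_add _ _ hz, ← Finset.sum_erase_add _ _ hz, add_assoc]
  refine add_le_add (Finset.sum_le_sum fun w _ => le_self_add.trans (key w)) ?_
  exact (add_le_add_right hle _).trans (key z)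

theorem exists_isGrid_excess_lt (hN : 0 < N) {S : Finset ℝ≥0} {R : ℝ}
    {v : Fin m → ℝ≥0 → ℝ≥0∞} {r : Fin m → ℝ≥0 → ℝ}
    (hr : ∀ i s, 0 < s → volume (Metric.ball (0 : EuclideanSpace ℝ (Fin N)) (r i s)) = v i s)
    {G : (Fin m → ℝ≥0) → ℝ≥0}
    (hG : Continuous G) (hmono : NondecreasingInEach G) (hsuper : Supermodular G)
    {V : ℝ≥0 → ℝ≥0} (hVm : Measurable V) (hV : ∀ r s : ℝ≥0, 0 < r → r ≤ s → V s ≤ V r)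
    {U : Fin m → EuclideanSpace ℝ (Fin N) → ℝ≥0} (hU : IsGrid S R v U)
    {ε : ℝ≥0∞} (hε : ε ≠ 0) :
    ∃ W : Fin m → EuclideanSpace ℝ (Fin N) → ℝ≥0, IsGrid S R v W ∧ Q G V U ≤ Q G V W ∧
      excess S r W < ε := by
  by_contra! hcon
  obtain ⟨η, hη, H⟩ := exists_polarize_excess_lt (S := S) hN hr hε
  set C : Set ℝ≥0∞ := {d | ∃ W : Fin m → EuclideanSpace ℝ (Fin N) → ℝ≥0, IsGrid S R v W ∧
    Q G V U ≤ Q G V W ∧ excess S r W = d} with hC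
  have hfin : excess S r U ≠ ∞ := by
    refine (ENNReal.sum_lt_top.mpr fun z hz => ?_).ne
    have hz0 : 0 < z.2 := by simpa using (Finset.mem_filter.mp (Finset.mem_product.mp hz).2).2
    exact (measure_mono (Set.sdiff_subset.trans (hU.subset z.1 z.2 hz0))).trans_lt
      measure_ball_lt_top
  have hI : sInf C ≠ ∞ := ne_top_of_le_ne_top hfin (sInf_le ⟨U, hU, le_rfl, rfl⟩)
  -- A competitor within `η` of the infimum would be polarized to one strictly below it.
  obtain ⟨_, ⟨W, hW, hQ, rfl⟩, hlt⟩ := sInf_lt_iff.mp (ENNReal.lt_add_right hI hη.ne')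
  obtain ⟨e, t, he, ht, hle⟩ := H W hW (hcon W hW hQ)
  have hmem : excess S r (fun i => polarize e t (W i)) ∈ C :=
    ⟨_, hW.polarize he ht, hQ.trans (Q_le_Q_polarize_of_measurable hN he hG hmono hsuper hVm hV
      hW.measurable), rfl⟩
  exact absurd (((add_le_add_left (sInf_le hmem) η).trans hle).trans_lt hlt) (lt_irrefl _)

/-- The integrand changes only at pairs with a point in `Z`; it is at most `M * b * M` and vanishes
unless both points lie in the ball. -/
theorem Q_le_Q_add_of_eqOn_compl {G : (Fin m → ℝ≥0) → ℝ≥0} {V : ℝ≥0 → ℝ≥0} {b M : ℝ≥0}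
    (hVb : ∀ s, V s ≤ b) {R : ℝ} {U T : Fin m → EuclideanSpace ℝ (Fin N) → ℝ≥0}
    (hM : ∀ x, G (fun i => U i x) ≤ M)
    (hR : ∀ x, x ∉ Metric.ball 0 R → G (fun i => U i x) = 0)
    {Z : Set (EuclideanSpace ℝ (Fin N))} (hZ : MeasurableSet Z)
    (hUT : ∀ x, x ∉ Z → ∀ i, U i x = T i x) :
    Q G V U ≤ Q G V T + M * b * M *
      (2 * volume (Metric.ball (0 : EuclideanSpace ℝ (Fin N)) R)) * volume Z := by
  set B := Metric.ball (0 : EuclideanSpace ℝ (Fin N)) R with hB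
  have hBm : MeasurableSet B := measurableSet_ball
  let χ : Set (EuclideanSpace ℝ (Fin N)) → EuclideanSpace ℝ (Fin N) → ℝ≥0∞ :=
    fun A => A.indicator 1
  have hχ : ∀ A, MeasurableSet A → Measurable (χ A) := fun A hA => measurable_one.indicator hA
  have hpt : ∀ x y, ((G (fun i => U i x) * V ‖x - y‖₊ * G (fun i => U i y) : ℝ≥0) : ℝ≥0∞)
      ≤ ((G (fun i => T i x) * V ‖x - y‖₊ * G (fun i => T i y) : ℝ≥0) : ℝ≥0∞)
        + M * b * M * (χ Z x * χ B y + χ B x * χ Z y) := by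
    intro x y
    by_cases hxB : x ∈ B
    swap
    · simp [hR x hxB]
    by_cases hyB : y ∈ B
    swap
    · simp [hR y hyB]
    by_cases hxy : x ∉ Z ∧ y ∉ Z
    · simp only [hUT x hxy.1, hUT y hxy.2]
      exact le_self_add
    · refine le_trans ?_ le_add_self
      have h1 : (1 : ℝ≥0∞) ≤ χ Z x * χ B y + χ B x * χ Z y := by
        simp only [χ, Set.indicator_of_mem hxB, Set.indicator_of_mem hyB, Pi.one_apply]
        rw [not_and_or, not_not, not_not] at hxy
        rcases hxy with h | h
        · simp [h]
        · simp [h]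
      calc ((G (fun i => U i x) * V ‖x - y‖₊ * G (fun i => U i y) : ℝ≥0) : ℝ≥0∞)
          ≤ ((M * b * M : ℝ≥0) : ℝ≥0∞) := by
            rw [ENNReal.coe_le_coe]
            gcongr
            exacts [hM x, hVb _, hM y]
        _ = M * b * M * 1 := by push_cast; ring
        _ ≤ _ := by gcongr
  have hint : ∀ (f : EuclideanSpace ℝ (Fin N) → ℝ≥0∞) (k c d : ℝ≥0∞)
      (A A' : Set (EuclideanSpace ℝ (Fin N))), MeasurableSet A → MeasurableSet A' →
      ∫⁻ x, f x + k * (c * χ A x + d * χ A' x)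
        = (∫⁻ x, f x) + k * (c * volume A + d * volume A') := by
    intro f k c d A A' hA hA'
    have h1 : Measurable fun x => c * χ A x := (hχ A hA).const_mul c
    have h2 : Measurable fun x => d * χ A' x := (hχ A' hA').const_mul d
    have h3 : Measurable fun x => c * χ A x + d * χ A' x := h1.add h2
    rw [lintegral_add_right _ (h3.const_mul k), lintegral_const_mul _ h3, lintegral_add_left h1,
      lintegral_const_mul _ (hχ A hA), lintegral_const_mul _ (hχ A' hA'),
      lintegral_indicator_one hA, lintegral_indicator_one hA']
  calc Q G V U ≤ ∫⁻ x, (∫⁻ y, ((G (fun i => T i x) * V ‖x - y‖₊ * G (fun i => T i y) : ℝ≥0) : ℝ≥0∞))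
        + M * b * M * (volume B * χ Z x + volume Z * χ B x) := by
        refine lintegral_mono fun x => (lintegral_mono (hpt x)).trans_eq ?_
        rw [hint _ _ _ _ _ _ hBm hZ, mul_comm (χ Z x), mul_comm (χ B x)]
    _ = _ := by
        rw [hint _ _ _ _ _ _ hZ hBm, Q]
        ring

theorem Q_le_Q_radialGrid (hN : 0 < N) {S : Finset ℝ≥0} (hS : 0 ∈ S) {R : ℝ}
    {G : (Fin m → ℝ≥0) → ℝ≥0} (hG0 : G 0 = 0)
    (hG : Continuous G) (hmono : NondecreasingInEach G) (hsuper : Supermodular G)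
    {V : ℝ≥0 → ℝ≥0} (hVm : Measurable V) (hV : ∀ r s : ℝ≥0, 0 < r → r ≤ s → V s ≤ V r)
    {b : ℝ≥0} (hVb : ∀ s, V s ≤ b)
    {U : Fin m → EuclideanSpace ℝ (Fin N) → ℝ≥0} (hU : ∀ i, Measurable (U i))
    (hUS : ∀ i x, U i x ∈ S) (hUR : ∀ i x, R ≤ ‖x‖ → U i x = 0) :
    Q G V U ≤ Q G V (fun i => radialGrid (N := N) S fun s => volume {x | s ≤ U i x}) := by
  set v : Fin m → ℝ≥0 → ℝ≥0∞ := fun i s => volume {x | s ≤ U i x} with hv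
  have hanti : ∀ i, Antitone (v i) := fun i s s' h => measure_mono fun x hx => h.trans hx
  have hgrid : IsGrid S R v U := by
    refine ⟨hU, hUS, fun i s hs x hx => ?_, fun _ _ _ => rfl⟩
    rw [mem_ball_zero_iff]
    by_contra! h
    rw [Set.mem_ofPred_eq, hUR i x h] at hx
    exact absurd hx (not_le.mpr hs)
  have hfin : ∀ i s, 0 < s → v i s ≠ ∞ := fun i s hs =>
    measure_ne_top_of_subset (hgrid.subset i s hs) measure_ball_lt_top.ne
  have hex : ∀ i s, ∃ r : ℝ, 0 < s → ({x : EuclideanSpace ℝ (Fin N) |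
        volume (Metric.ball (0 : EuclideanSpace ℝ (Fin N)) ‖x‖) < v i s} = Metric.ball 0 r ∧
      volume (Metric.ball (0 : EuclideanSpace ℝ (Fin N)) r) = v i s) := by
    intro i s
    by_cases hs : 0 < s
    · obtain ⟨r, hr⟩ := exists_ball_volume_eq hN (hfin i s hs)
      exact ⟨r, fun _ => hr⟩
    · exact ⟨0, fun h => absurd h hs⟩
  choose r hr using hex
  set C : ℝ≥0∞ := G (fun _ => S.sup id) * b * G (fun _ => S.sup id) *
    (2 * volume (Metric.ball (0 : EuclideanSpace ℝ (Fin N)) R)) with hC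
  have hCfin : C * 2 ≠ ∞ := ENNReal.mul_ne_top (ENNReal.mul_ne_top (by finiteness)
    (ENNReal.mul_ne_top (by norm_num) measure_ball_lt_top.ne)) (by norm_num)
  have hbound : ∀ W : Fin m → EuclideanSpace ℝ (Fin N) → ℝ≥0, IsGrid S R v W →
      Q G V W ≤ Q G V (fun i => radialGrid (N := N) S (v i)) + C * 2 * excess S r W := by
    intro W hW
    let A : Fin m × ℝ≥0 → Set (EuclideanSpace ℝ (Fin N)) := fun z => {x | z.2 ≤ W z.1 x}
    let B : Fin m × ℝ≥0 → Set (EuclideanSpace ℝ (Fin N)) := fun z => Metric.ball 0 (r z.1 z.2)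
    have hAm : ∀ z, MeasurableSet (A z) := fun z => hW.measurableSet z.1 z.2
    have hBm : ∀ z, MeasurableSet (B z) := fun z => measurableSet_ball
    let I : Finset (Fin m × ℝ≥0) := Finset.univ ×ˢ S.filter (0 < ·)
    have hI : ∀ z, z ∈ I ↔ z.2 ∈ S ∧ 0 < z.2 := by simp [I]
    -- Off the union of the symmetric differences, `W i` and the radial function have the same
    -- positive levels in `S`; as both take values in `S`, they agree.
    let Z : Set (EuclideanSpace ℝ (Fin N)) := ⋃ z ∈ I, (A z \ B z ∪ B z \ A z)
    have hZm : MeasurableSet Z := Finset.measurableSet_biUnion _ fun z _ =>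
      ((hAm z).diff (hBm z)).union ((hBm z).diff (hAm z))
    have hZ : volume Z ≤ 2 * excess S r W := by
      rw [excess, Finset.mul_sum]
      refine (measure_biUnion_finset_le _ _).trans (Finset.sum_le_sum fun z hz => ?_)
      have hz0 := ((hI z).mp hz).2
      refine (measure_union_le _ _).trans_eq ?_
      rw [measure_sdiff_comm_of_eq (hAm z) (hBm z), two_mul]
      · exact measure_ne_top_of_subset (hW.subset z.1 z.2 hz0) measure_ball_lt_top.ne
      · rw [hW.volume_eq _ _ hz0, (hr _ _ hz0).2]
    have heq : ∀ x, x ∉ Z → ∀ i, W i x = radialGrid S (v i) x := by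
      intro x hx i
      have hlev : ∀ s ∈ S, 0 < s → (s ≤ W i x ↔ s ≤ radialGrid S (v i) x) := by
        intro s hs hs0
        have hx' : x ∉ A (i, s) \ B (i, s) ∪ B (i, s) \ A (i, s) := fun h =>
          hx (Set.mem_biUnion (show (i, s) ∈ I from (hI _).mpr ⟨hs, hs0⟩) h)
        have h1 : x ∈ A (i, s) ↔ s ≤ W i x := Iff.rfl
        have h2 : x ∈ B (i, s) ↔ s ≤ radialGrid S (v i) x := by
          rw [le_radialGrid_iff (hanti i) hs hs0]
          change x ∈ Metric.ball 0 (r i s) ↔ _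
          rw [← (hr i s hs0).1]
          rfl
        rw [← h1, ← h2]
        simp only [Set.mem_union, Set.mem_sdiff] at hx'
        tauto
      refine le_antisymm ?_ ?_
      · rcases eq_or_ne (W i x) 0 with h | h
        · rw [h]; exact zero_le
        · exact (hlev _ (hW.mem i x) (pos_iff_ne_zero.mpr h)).mp le_rfl
      · rcases eq_or_ne (radialGrid S (v i) x) 0 with h | h
        · rw [h]; exact zero_le
        · exact (hlev _ (radialGrid_mem hS _ _) (pos_iff_ne_zero.mpr h)).mpr le_rfl
    refine (Q_le_Q_add_of_eqOn_compl (M := G fun _ => S.sup id) hVb (R := R) (fun x => ?_)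
      (fun x hx => ?_) hZm heq).trans ?_
    · exact hmono.monotone fun i => Finset.le_sup (f := id) (hW.mem i x)
    · have : (fun i => W i x) = 0 := by
        ext1 i
        by_contra h
        exact hx (hW.subset i (W i x) (pos_iff_ne_zero.mpr h) (le_refl (W i x)))
      rw [this, hG0]
    · rw [mul_assoc C 2]
      gcongr
  refine ENNReal.le_of_forall_pos_le_add fun ε hε _ => ?_
  obtain ⟨δ, hδ, hlt⟩ := ENNReal.exists_nnreal_pos_mul_lt hCfin
    (b := (ε : ℝ≥0∞)) (by exact_mod_cast hε.ne')
  obtain ⟨W, hW, hQ, hD⟩ := exists_isGrid_excess_lt hN (fun i s hs => (hr i s hs).2) hG hmono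
    hsuper hVm hV hgrid (ε := δ) (by exact_mod_cast hδ.ne')
  refine hQ.trans ((hbound W hW).trans ?_)
  gcongr
  refine le_trans ?_ hlt.le
  rw [mul_comm]
  gcongr

end Grid

/-! ### Passage to general functions and kernels -/

section Approximation

variable {N m : ℕ}

theorem schwarz_congr_ae {u w : EuclideanSpace ℝ (Fin N) → ℝ≥0} (h : u =ᵐ[volume] w) :
    schwarz u = schwarz w := by
  have : ∀ s : ℝ≥0, volume {y | s < u y} = volume {y | s < w y} := fun s =>
    measure_congr (by filter_upwards [h] with y hy; exact congrArg (s < ·) hy)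
  funext x
  simp only [schwarz, this]

/-- The grid uses the sets `s ≤ u` and `schwarz` the sets `d < w`; the former lie in the latter for
every `d < s`, and letting `d` rise to `s` suffices. -/
theorem radialGrid_le_schwarz {p : ℝ} (hp : 1 < p) {u w : EuclideanSpace ℝ (Fin N) → ℝ≥0}
    (hw : MemLp (fun x => (w x : ℝ)) (ENNReal.ofReal p) volume) (huw : ∀ x, u x ≤ w x)
    (S : Finset ℝ≥0) {x : EuclideanSpace ℝ (Fin N)} (hx : 0 < ‖x‖) :
    radialGrid S (fun s => volume {y | s ≤ u y}) x ≤ schwarz w x := by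
  refine Finset.sup_le fun s _ => ?_
  split_ifs with h
  swap
  · exact zero_le
  refine le_of_forall_lt fun c hc => ?_
  obtain ⟨d, hcd, hds⟩ := exists_between hc
  refine hcd.trans_le (le_csSup (bddAbove_levels hp hw x hx) (h.trans_le (measure_mono ?_)))
  intro y hy
  exact hds.trans_le (le_trans hy (huw y))

/-- The approximation of `u` from below on the ball of radius `n`, with values in
`{0, 1 / n, …, n}`. -/
noncomputable def gridApprox (n : ℕ) (u : EuclideanSpace ℝ (Fin N) → ℝ≥0)
    (x : EuclideanSpace ℝ (Fin N)) : ℝ≥0 :=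
  (Metric.ball 0 (n : ℝ)).indicator (fun x => ((min ⌊n * u x⌋₊ (n ^ 2) : ℕ) : ℝ≥0) / n) x

theorem gridApprox_mem (n : ℕ) (u : EuclideanSpace ℝ (Fin N) → ℝ≥0)
    (x : EuclideanSpace ℝ (Fin N)) :
    gridApprox n u x ∈ (Finset.range (n ^ 2 + 1)).image fun j : ℕ => (j : ℝ≥0) / n := by
  rw [Finset.mem_image, gridApprox]
  by_cases hx : x ∈ Metric.ball 0 (n : ℝ)
  · rw [Set.indicator_of_mem hx]
    exact ⟨_, Finset.mem_range.mpr (Nat.lt_succ_of_le (min_le_right _ _)), rfl⟩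
  · rw [Set.indicator_of_notMem hx]
    exact ⟨0, by simp, by simp⟩

theorem measurable_gridApprox (n : ℕ) {u : EuclideanSpace ℝ (Fin N) → ℝ≥0} (hu : Measurable u) :
    Measurable (gridApprox n u) := by
  refine Measurable.indicator (Measurable.div_const ?_ _) measurableSet_ball
  exact (measurable_from_nat (f := fun k : ℕ => ((min k (n ^ 2) : ℕ) : ℝ≥0))).comp
    (Nat.measurable_floor.comp (hu.const_mul _))

theorem gridApprox_le (n : ℕ) (u : EuclideanSpace ℝ (Fin N) → ℝ≥0)
    (x : EuclideanSpace ℝ (Fin N)) : gridApprox n u x ≤ u x := by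
  refine Set.indicator_apply_le' (fun _ => ?_) (fun _ => zero_le)
  rcases n.eq_zero_or_pos with rfl | hn
  · simp
  · rw [div_le_iff₀ (by exact_mod_cast hn), mul_comm]
    exact (Nat.cast_le.mpr (min_le_left _ _)).trans (Nat.floor_le zero_le)

theorem tendsto_gridApprox (u : EuclideanSpace ℝ (Fin N) → ℝ≥0)
    (x : EuclideanSpace ℝ (Fin N)) :
    Filter.Tendsto (fun n => gridApprox n u x) Filter.atTop (nhds (u x)) := by
  have h1 : Filter.Tendsto (fun n : ℕ => (⌊(n : ℝ≥0) * u x⌋₊ : ℝ≥0) / n) Filter.atTop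
      (nhds (u x)) := by
    rw [← NNReal.tendsto_coe]
    have := (tendsto_nat_floor_mul_div_atTop (R := ℝ) (u x).coe_nonneg).comp
      tendsto_natCast_atTop_atTop
    refine this.congr fun n => ?_
    simp only [Function.comp, NNReal.coe_div, NNReal.coe_natCast]
    congr 2
    refine Nat.floor_congr fun k => ?_
    rw [← NNReal.coe_le_coe, NNReal.coe_natCast, NNReal.coe_mul, NNReal.coe_natCast, mul_comm]
  refine h1.congr' ?_
  obtain ⟨k, hk⟩ := exists_nat_gt (max ‖x‖ (u x))
  filter_upwards [Filter.eventually_ge_atTop k] with n hn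
  have hn' : max ‖x‖ (u x : ℝ) < n := hk.trans_le (by exact_mod_cast hn)
  have hx : x ∈ Metric.ball 0 (n : ℝ) := by
    rw [mem_ball_zero_iff]; exact (le_max_left _ _).trans_lt hn'
  have hu : u x ≤ n := by
    rw [← NNReal.coe_le_coe]; exact (le_max_right _ _).trans hn'.le
  rw [gridApprox, Set.indicator_of_mem hx, min_eq_left]
  refine Nat.floor_le_of_le ?_
  push_cast
  rw [sq]
  gcongr

/-- Fatou's lemma, applied in each variable; pointwise convergence without monotonicity is enough.
-/
theorem Q_le_of_tendsto {G : (Fin m → ℝ≥0) → ℝ≥0} (hG : Continuous G)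
    {V : ℝ≥0 → ℝ≥0} {V' : ℕ → ℝ≥0 → ℝ≥0} (hV' : ∀ n, Measurable (V' n))
    (hV : ∀ s, Filter.Tendsto (fun n => V' n s) Filter.atTop (nhds (V s)))
    {U : Fin m → EuclideanSpace ℝ (Fin N) → ℝ≥0}
    {U' : ℕ → Fin m → EuclideanSpace ℝ (Fin N) → ℝ≥0} (hU' : ∀ n i, Measurable (U' n i))
    (hU : ∀ i x, Filter.Tendsto (fun n => U' n i x) Filter.atTop (nhds (U i x)))
    {c : ℝ≥0∞} (hc : ∀ n, Q G (V' n) (U' n) ≤ c) : Q G V U ≤ c := by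
  have hGt : ∀ x, Filter.Tendsto (fun n => G fun i => U' n i x) Filter.atTop
      (nhds (G fun i => U i x)) := fun x =>
    (hG.tendsto _).comp (tendsto_pi_nhds.mpr fun i => hU i x)
  have hGm : ∀ n, Measurable fun x => G fun i => U' n i x := fun n =>
    hG.measurable.comp (measurable_pi_lambda _ (hU' n))
  have hm : ∀ n, Measurable fun z : EuclideanSpace ℝ (Fin N) × EuclideanSpace ℝ (Fin N) =>
      ((G (fun i => U' n i z.1) * V' n ‖z.1 - z.2‖₊ * G (fun i => U' n i z.2) : ℝ≥0) : ℝ≥0∞) :=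
    fun n => ((((hGm n).comp measurable_fst).mul ((hV' n).comp
      (measurable_fst.sub measurable_snd).nnnorm)).mul ((hGm n).comp measurable_snd)).coe_nnreal_ennreal
  have hlim : ∀ x y, Filter.liminf (fun n => ((G (fun i => U' n i x) * V' n ‖x - y‖₊
      * G (fun i => U' n i y) : ℝ≥0) : ℝ≥0∞)) Filter.atTop
      = ((G (fun i => U i x) * V ‖x - y‖₊ * G (fun i => U i y) : ℝ≥0) : ℝ≥0∞) := fun x y =>
    (ENNReal.tendsto_coe.mpr (((hGt x).mul (hV _)).mul (hGt y))).liminf_eq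
  calc Q G V U ≤ ∫⁻ x, Filter.liminf (fun n => ∫⁻ y, ((G (fun i => U' n i x) * V' n ‖x - y‖₊
        * G (fun i => U' n i y) : ℝ≥0) : ℝ≥0∞)) Filter.atTop := by
        refine lintegral_mono fun x => ?_
        simp only [← hlim x]
        exact lintegral_liminf_le fun n => (hm n).comp measurable_prodMk_left
    _ ≤ Filter.liminf (fun n => Q G (V' n) (U' n)) Filter.atTop :=
        lintegral_liminf_le fun n => (hm n).lintegral_prod_right'
    _ ≤ c := Filter.liminf_le_of_le (by isBoundedDefault) fun b hb => by
        obtain ⟨n, hn⟩ := hb.exists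
        exact hn.trans (hc n)

theorem Q_le_Q_schwarz (hN : 0 < N) {p : ℝ} (hp : 1 < p) {G : (Fin m → ℝ≥0) → ℝ≥0} (hG0 : G 0 = 0)
    (hG : Continuous G) (hmono : NondecreasingInEach G) (hsuper : Supermodular G)
    {V : ℝ≥0 → ℝ≥0} (hVm : Measurable V) (hV : ∀ r s : ℝ≥0, 0 < r → r ≤ s → V s ≤ V r)
    {U : Fin m → EuclideanSpace ℝ (Fin N) → ℝ≥0}
    (hU : ∀ i, MemLp (fun x => (U i x : ℝ)) (ENNReal.ofReal p) volume) :
    Q G V U ≤ Q G V fun i => schwarz (U i) := by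
  have : Nonempty (Fin N) := ⟨⟨0, hN⟩⟩
  -- Both `Q` and `schwarz` depend only on almost-everywhere classes.
  wlog hUm : ∀ i, Measurable (U i) generalizing U
  · have hae : ∀ i, AEMeasurable (U i) := fun i => by
      simpa using (hU i).1.aemeasurable.real_toNNReal
    have hW := fun i => (hae i).ae_eq_mk
    rw [Q_congr_ae G V hW]
    simp only [fun i => schwarz_congr_ae (hW i)]
    refine this (fun i => (memLp_congr_ae ?_).mp (hU i)) fun i => (hae i).measurable_mk
    filter_upwards [hW i] with x hx
    rw [hx]
  have hpos : ∀ᵐ x : EuclideanSpace ℝ (Fin N), 0 < ‖x‖ := by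
    simp only [norm_pos_iff]
    simp [ae_iff]
  -- Capping `V` at `n` keeps it non-increasing and supplies the bound needed in the finitely valued
  -- case.
  refine Q_le_of_tendsto hG (V' := fun n s => min (V s) n) (fun n => hVm.min measurable_const)
    (fun s => ?_) (U' := fun n i => gridApprox n (U i))
    (fun n i => measurable_gridApprox n (hUm i)) (fun i x => tendsto_gridApprox (U i) x) fun n => ?_
  · refine tendsto_const_nhds.congr' ?_
    obtain ⟨k, hk⟩ := exists_nat_ge (V s)
    filter_upwards [Filter.eventually_ge_atTop k] with n hn
    rw [min_eq_left (hk.trans (by exact_mod_cast hn))]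
  · refine (Q_le_Q_radialGrid hN (R := n)
      (S := (Finset.range (n ^ 2 + 1)).image fun j : ℕ => (j : ℝ≥0) / n)
      (Finset.mem_image.mpr ⟨0, by simp, by simp⟩) hG0 hG hmono hsuper
      (hVm.min measurable_const) (fun r s hr hrs => min_le_min_right _ (hV r s hr hrs))
      (b := n) (fun s => min_le_right _ _) (fun i => measurable_gridApprox n (hUm i))
      (fun i => gridApprox_mem n (U i)) (fun i x hx => ?_)).trans ?_
    · exact Set.indicator_of_notMem (by simpa using hx) _
    have hle : ∀ x : EuclideanSpace ℝ (Fin N), 0 < ‖x‖ →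
        G (fun i => radialGrid ((Finset.range (n ^ 2 + 1)).image fun j : ℕ => (j : ℝ≥0) / n)
          (fun s => volume {y | s ≤ gridApprox n (U i) y}) x) ≤ G fun i => schwarz (U i) x :=
      fun x hx => hmono.monotone fun i =>
        radialGrid_le_schwarz hp (hU i) (gridApprox_le n (U i)) _ hx
    refine lintegral_mono_ae ?_
    filter_upwards [hpos] with x hx
    refine lintegral_mono_ae ?_
    filter_upwards [hpos] with y hy
    rw [ENNReal.coe_le_coe]
    exact mul_le_mul' (mul_le_mul' (hle x hx) (min_le_left _ _)) (hle y hy)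

end Approximation

end Rearrangement

/-! ### Conclusion -/

theorem proposition3p7 {N m : ℕ} (hN : 0 < N) (p pstar q : ℝ) (hp : 1 < p) (hq : 1 < q)
    (hpstar_lt : p < N → pstar = p * N / (N - p)) (hpstar_ge : (N : ℝ) ≤ p → p < pstar)
    (G : (Fin m → ℝ≥0) → ℝ≥0) (hG : Continuous G)
    (V : ℝ≥0 → ℝ≥0) (hV : Measurable V)
    (μ : Fin m → ℝ) (K : ℝ≥0)
    (hG1 : ∀ s : Fin m → ℝ≥0, G s ≤ K * ∑ i, s i ^ μ i)
    (hμ_lower : ∀ i, p * ((2 * q - 1) / (2 * q)) < μ i)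
    (hμ_upper : ∀ i, μ i < pstar * ((2 * q - 1) / (2 * q)))
    (hG2 : Rearrangement.MemWeakLp q (fun x : EuclideanSpace ℝ (Fin N) => (V ‖x‖₊ : ℝ)))
    (hG2' : ∀ i, (N : ℝ) * (μ i / p - (2 * q - 1) / (2 * q)) < p / 2)
    (hG3 : ∀ r s : ℝ≥0, 0 < r → r ≤ s → V s ≤ V r)
    (hG4_mono : Rearrangement.NondecreasingInEach G)
    (hG4_super : Rearrangement.Supermodular G)
    (U : Fin m → EuclideanSpace ℝ (Fin N) → ℝ≥0)
    (hU : ∀ i, MemLp (fun x => (U i x : ℝ)) (ENNReal.ofReal p) volume)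
    (hU' : ∀ i, MemLp (fun x => (U i x : ℝ)) (ENNReal.ofReal pstar) volume) :
    (∀ (e : EuclideanSpace ℝ (Fin N)) (t : ℝ), ‖e‖ = 1 →
      Rearrangement.Q G V U ≤ Rearrangement.Q G V (fun i => Rearrangement.polarize e t (U i))) ∧
    Rearrangement.Q G V U ≤ Rearrangement.Q G V (fun i => Rearrangement.schwarz (U i)) := by
  -- The exponents are positive, so the growth bound vanishes at `0`; thus `G` of a boundedly
  -- supported function has bounded support.
  have hG0 : G 0 = 0 := by
    have h := hG1 0
    have hμ : ∀ i, μ i ≠ 0 := fun i => by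
      have h1 : 0 < p * ((2 * q - 1) / (2 * q)) :=
        mul_pos (by linarith) (div_pos (by linarith) (by linarith))
      exact (h1.trans (hμ_lower i)).ne'
    simpa [NNReal.zero_rpow (hμ _)] using h
  refine ⟨fun e t he => ?_, Rearrangement.Q_le_Q_schwarz hN hp hG0 hG hG4_mono hG4_super hV hG3 hU⟩
  refine Rearrangement.Q_le_Q_polarize hN he hG hG4_mono hG4_super hV hG3 fun i => ?_
  simpa using (hU i).1.aemeasurable.real_toNNReal
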